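/- Let $\alpha\in\mathbb R$, let $\mathbb T=\{z\in\mathbb C : |z|=1\}$ with normalised Haar measure $m$, and for $\beta\in\mathbb R$ let $R_\beta z=e^{2\pi i\beta}z$ on $\mathbb T$. Let $\mathbb A_\alpha$ be the noncommutative $2$-torus, i.e. the universal unital $C^*$-algebra generated by two unitaries $U,V$ with $UV=e^{2\pi i\alpha}VU$, and let $\tau$ be its canonical trace, the state with $\tau(U^mV^n)=\delta_{m,0}\delta_{n,0}$ for $m,n\in\mathbb Z$. Let $\theta\in\mathbb R$ be such that $\theta/2\pi$ is irrational and let $f:\mathbb T\to\mathbb T$ be continuous. Let $\Phi_{\theta,f}$ be the Anzai skew-product, i.e. the $*$-automorphism of $\mathbb A_\alpha$ determined by $$\Phi_{\theta,f}(U)=e^{i\theta}U,\qquad \Phi_{\theta,f}(V)=f(U)V,$$ where $f(U)$ is given by the continuous functional calculus. For $n\in\mathbb Z$ define $f_n:\mathbb T\to\mathbb T$ by $$f_n(z)=\prod_{l=0}^{n-1}f(R_{-l\alpha}z)\ \ (n>0),\qquad f_0(z)=1,\qquad f_n(z)=\prod_{l=1}^{|n|}\overline{f(R_{l\alpha}z)}\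 \ (n<0).$$ Then the $C^*$-dynamical system $(\mathbb A_\alpha,\Phi_{\theta,f},\tau)$ is ergodic, i.e. $\tau$ is an extreme point of the convex set of $\Phi_{\theta,f}$-invariant states of $\mathbb A_\alpha$, if and only if, for every $n\in\mathbb Z\setminus\{0\}$, the cohomological equation $$(g\circ R_{\theta/2\pi})\,f_n=g\qquad m\text{-almost everywhere}$$ has no nonzero solution $g\in L^2(\mathbb T,m)$. -/

import Mathlib

open scoped ENNReal ComplexOrder ComplexConjugate InnerProductSpace

noncomputable section

namespace NCTorus

/-! ### The universal C⋆-algebra of the noncommutative 2-torus -/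

/-- `u, v` are unitaries of the unital C⋆-algebra `B` with `u v = e^{2πiα} v u`. -/
structure IsTorusPair (α : ℝ) {B : Type*} [CStarAlgebra B] (u v : B) : Prop where
  u_mem : u ∈ unitary B
  v_mem : v ∈ unitary B
  comm : u * v = Complex.exp (2 * Real.pi * Complex.I * α) • (v * u)

/-- A representation of the defining relations in a (nonzero) unital C⋆-algebra. -/
structure TorusRep (α : ℝ) : Type 1 where
  carrier : Type
  [cstar : CStarAlgebra carrier]
  [nontriv : Nontrivial carrier]
  u : carrier
  v : carrier
  pair : IsTorusPair α u v

attribute [instance] TorusRep.cstar TorusRep.nontriv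

/-- The C⋆-algebra of bounded families indexed by all representations of the relations. -/
abbrev Ambient (α : ℝ) : Type 1 := lp (fun i : TorusRep α => i.carrier) ∞

instance instCStarAlgebraAmbient (α : ℝ) : CStarAlgebra (Ambient α) where

theorem norm_le_one_of_unitary {B : Type*} [CStarAlgebra B] {u : B} (hu : u ∈ unitary B) :
    ‖u‖ ≤ 1 := by
  rcases subsingleton_or_nontrivial B with h | h
  · simp [Subsingleton.elim u 0]
  · exact (CStarRing.norm_of_mem_unitary hu).le

/-- The family of all first generators. -/
def ambientU (α : ℝ) : Ambient α :=
  ⟨fun i => i.u, memℓp_infty ⟨1, by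
    rintro _ ⟨i, rfl⟩; exact norm_le_one_of_unitary i.pair.u_mem⟩⟩

/-- The family of all second generators. -/
def ambientV (α : ℝ) : Ambient α :=
  ⟨fun i => i.v, memℓp_infty ⟨1, by
    rintro _ ⟨i, rfl⟩; exact norm_le_one_of_unitary i.pair.v_mem⟩⟩

/-- The closed unital ⋆-subalgebra generated by the two universal generators. -/
def torusSubalgebra (α : ℝ) : StarSubalgebra ℂ (Ambient α) :=
  (StarAlgebra.adjoin ℂ {ambientU α, ambientV α}).topologicalClosure

end NCTorus

/-- The noncommutative 2-torus `𝔸_α`: the universal unital C⋆-algebra generated by two unitaries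
`U, V` with `U V = e^{2πiα} V U`. It is realised as the C⋆-algebra generated by the universal pair
inside the product of all representations of the relations; `NCTorus.existsUnique_lift` is its
universal property. -/
def NCTorus (α : ℝ) : Type 1 := NCTorus.torusSubalgebra α

namespace NCTorus

instance instCStarAlgebra (α : ℝ) : CStarAlgebra (NCTorus α) :=
  StarSubalgebra.cstarAlgebra (torusSubalgebra α)
    (h_closed := StarSubalgebra.isClosed_topologicalClosure _)

/-- The first universal generator. -/
def U (α : ℝ) : NCTorus α :=
  ⟨ambientU α, StarSubalgebra.le_topologicalClosure _
    (StarAlgebra.subset_adjoin ℂ _ (by simp))⟩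

/-- The second universal generator. -/
def V (α : ℝ) : NCTorus α :=
  ⟨ambientV α, StarSubalgebra.le_topologicalClosure _
    (StarAlgebra.subset_adjoin ℂ _ (by simp))⟩

theorem pair_UV (α : ℝ) : IsTorusPair α (U α) (V α) where
  u_mem := by
    rw [Unitary.mem_iff]
    constructor
    · apply Subtype.ext; apply lp.ext; funext i; exact (Unitary.mem_iff.mp i.pair.u_mem).1
    · apply Subtype.ext; apply lp.ext; funext i; exact (Unitary.mem_iff.mp i.pair.u_mem).2
  v_mem := by
    rw [Unitary.mem_iff]
    constructor
    · apply Subtype.ext; apply lp.ext; funext i; exact (Unitary.mem_iff.mp i.pair.v_mem).1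
    · apply Subtype.ext; apply lp.ext; funext i; exact (Unitary.mem_iff.mp i.pair.v_mem).2
  comm := by
    apply Subtype.ext; apply lp.ext; funext i; exact i.pair.comm

/-- Evaluation of an element of the torus at a representation. -/
def eval {α : ℝ} (i : TorusRep α) : NCTorus α →⋆ₐ[ℂ] i.carrier where
  toFun x := x.1 i
  map_one' := rfl
  map_mul' _ _ := rfl
  map_zero' := rfl
  map_add' _ _ := rfl
  commutes' _ := rfl
  map_star' _ := rfl

theorem continuous_starAlgHom {A B : Type*} [CStarAlgebra A] [CStarAlgebra B]
    (φ : A →⋆ₐ[ℂ] B) : Continuous φ :=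
  AddMonoidHomClass.continuous_of_bound φ 1 (by
    simpa only [one_mul] using NonUnitalStarAlgHom.norm_apply_le φ)

/-- A ⋆-homomorphism on the torus is determined by its values on the two generators. -/
theorem hom_ext {α : ℝ} {B : Type*} [CStarAlgebra B] {φ ψ : NCTorus α →⋆ₐ[ℂ] B}
    (hU : φ (U α) = ψ (U α)) (hV : φ (V α) = ψ (V α)) : φ = ψ := by
  refine StarAlgHom.ext_topologicalClosure (S := StarAlgebra.adjoin ℂ {ambientU α, ambientV α})
    (continuous_starAlgHom φ) (continuous_starAlgHom ψ) ?_
  refine StarAlgHom.ext_adjoin ?_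
  rintro ⟨x, hx⟩ hx'
  rcases hx' with rfl | rfl
  · exact hU
  · exact hV

theorem exists_small_model (C : Type*) [CStarAlgebra C] [Small.{0} C] :
    ∃ (X : Type) (_ : CStarAlgebra X), Nonempty (X ≃⋆ₐ[ℂ] C) := by
  let e : Shrink.{0} C ≃ₐ[ℂ] C := Shrink.algEquiv ℂ C
  let nr : NormedRing (Shrink.{0} C) := NormedRing.induced _ C e e.injective
  let na : NormedAlgebra ℂ (Shrink.{0} C) := NormedAlgebra.induced ℂ (Shrink.{0} C) C e
  let sr : StarRing (Shrink.{0} C) :=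
    { star := fun x => e.symm (star (e x))
      star_involutive := fun x => by simp
      star_mul := fun x y => by simp
      star_add := fun x y => by simp }
  have hstar : ∀ x : Shrink.{0} C, e (star x) = star (e x) := fun x => e.apply_symm_apply _
  have hiso : Isometry e := Isometry.of_dist_eq fun _ _ => rfl
  have cs : CompleteSpace (Shrink.{0} C) :=
    (IsometryEquiv.mk e.toEquiv hiso).completeSpace
  have cr : CStarRing (Shrink.{0} C) :=
    ⟨fun x => by
      change ‖e x‖ * ‖e x‖ ≤ ‖e (star x * x)‖
      rw [map_mul, hstar, CStarRing.norm_star_mul_self]⟩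
  have sm : StarModule ℂ (Shrink.{0} C) := ⟨fun c x => e.injective (by simp [hstar])⟩
  exact ⟨Shrink.{0} C, { }, ⟨StarAlgEquiv.ofAlgEquiv e hstar⟩⟩

theorem small_closure_adjoin {B : Type*} [CStarAlgebra B] (u v : B) :
    Small.{0} (StarAlgebra.adjoin ℂ {u, v}).topologicalClosure := by
  have hset : ({u, v} ∪ star {u, v} : Set B) = Set.range ![u, v, star u, star v] := by
    ext x
    simp only [Set.mem_union, Set.mem_insert_iff, Set.mem_singleton_iff, Set.mem_star,
      Set.mem_range, Fin.exists_fin_succ, star_eq_iff_star_eq]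
    simp [eq_comm, or_assoc]
  have h1 : Small.{0} ((StarAlgebra.adjoin ℂ {u, v} : StarSubalgebra ℂ B) : Set B) := by
    have : ((StarAlgebra.adjoin ℂ {u, v} : StarSubalgebra ℂ B) : Set B)
        = Set.range (FreeAlgebra.lift ℂ ![u, v, star u, star v]) := by
      rw [← AlgHom.coe_range, ← Algebra.adjoin_range_eq_range_freeAlgebra_lift, ← hset]
      rfl
    rw [this]
    exact small_range _
  refine @small_subset _ _ _ ?_ (small_range.{0} fun x : ℕ →
    ((StarAlgebra.adjoin ℂ {u, v} : StarSubalgebra ℂ B) : Set B) =>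
      Filter.limUnder Filter.atTop fun n => (x n : B))
  intro y hy
  obtain ⟨x, hx, hlim⟩ := mem_closure_iff_seq_limit.mp hy
  exact ⟨fun n => ⟨x n, hx n⟩, hlim.limUnder_eq⟩

/-- The universal property of the noncommutative 2-torus. -/
theorem existsUnique_lift {α : ℝ} {B : Type*} [CStarAlgebra B] {u v : B}
    (h : IsTorusPair α u v) :
    ∃! φ : NCTorus α →⋆ₐ[ℂ] B, φ (U α) = u ∧ φ (V α) = v := by
  refine existsUnique_of_exists_of_unique ?_ fun φ ψ hφ hψ =>
    hom_ext (hφ.1.trans hψ.1.symm) (hφ.2.trans hψ.2.symm)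
  rcases subsingleton_or_nontrivial B with hB | hB
  · exact ⟨{ toFun := fun _ => 0
             map_one' := Subsingleton.elim _ _
             map_mul' := fun _ _ => Subsingleton.elim _ _
             map_zero' := rfl
             map_add' := fun _ _ => Subsingleton.elim _ _
             commutes' := fun _ => Subsingleton.elim _ _
             map_star' := fun _ => Subsingleton.elim _ _ },
      Subsingleton.elim _ _, Subsingleton.elim _ _⟩
  let S : StarSubalgebra ℂ B := (StarAlgebra.adjoin ℂ {u, v}).topologicalClosure
  have hS : IsClosed (S : Set B) := StarSubalgebra.isClosed_topologicalClosure _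
  let _ : CStarAlgebra S := StarSubalgebra.cstarAlgebra S (h_closed := hS)
  have hu : u ∈ S := StarSubalgebra.le_topologicalClosure _ (StarAlgebra.subset_adjoin ℂ _ (by simp))
  have hv : v ∈ S := StarSubalgebra.le_topologicalClosure _ (StarAlgebra.subset_adjoin ℂ _ (by simp))
  have : Small.{0} S := small_closure_adjoin u v
  obtain ⟨X, hX, ⟨e⟩⟩ := exists_small_model S
  let incl : X →⋆ₐ[ℂ] B := S.subtype.comp (e : X →⋆ₐ[ℂ] S)
  have hincl : Function.Injective incl := fun x y hxy => e.injective (Subtype.ext hxy)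
  have : Nontrivial X := ⟨⟨0, 1, fun h01 => zero_ne_one (α := B) (by
    simpa using congrArg incl h01)⟩⟩
  let u' : X := e.symm ⟨u, hu⟩
  let v' : X := e.symm ⟨v, hv⟩
  have hu' : incl u' = u := congrArg Subtype.val (e.apply_symm_apply ⟨u, hu⟩)
  have hv' : incl v' = v := congrArg Subtype.val (e.apply_symm_apply ⟨v, hv⟩)
  have hp : IsTorusPair α u' v' :=
    { u_mem := by
        rw [Unitary.mem_iff]
        constructor <;> apply hincl <;> simp only [map_mul, map_star, map_one, hu']
        · exact (Unitary.mem_iff.mp h.u_mem).1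
        · exact (Unitary.mem_iff.mp h.u_mem).2
      v_mem := by
        rw [Unitary.mem_iff]
        constructor <;> apply hincl <;> simp only [map_mul, map_star, map_one, hv']
        · exact (Unitary.mem_iff.mp h.v_mem).1
        · exact (Unitary.mem_iff.mp h.v_mem).2
      comm := by
        apply hincl
        rw [map_smul, map_mul, map_mul, hu', hv']
        exact h.comm }
  exact ⟨incl.comp (eval ⟨X, u', v', hp⟩), hu', hv'⟩

/-- The ⋆-homomorphism out of `𝔸_α` induced by a pair satisfying the relations. -/
def lift {α : ℝ} {B : Type*} [CStarAlgebra B] {u v : B} (h : IsTorusPair α u v) :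
    NCTorus α →⋆ₐ[ℂ] B :=
  (existsUnique_lift h).exists.choose

theorem lift_U {α : ℝ} {B : Type*} [CStarAlgebra B] {u v : B} (h : IsTorusPair α u v) :
    lift h (U α) = u := (existsUnique_lift h).exists.choose_spec.1

theorem lift_V {α : ℝ} {B : Type*} [CStarAlgebra B] {u v : B} (h : IsTorusPair α u v) :
    lift h (V α) = v := (existsUnique_lift h).exists.choose_spec.2

/-! ### The canonical trace -/

/-- The Hilbert space `ℓ²(ℤ × ℤ)`. -/
abbrev L2Z : Type := lp (fun _ : ℤ × ℤ => ℂ) 2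

theorem weightedShift_memℓp (σ : Equiv.Perm (ℤ × ℤ)) (c : ℤ × ℤ → Circle) (ξ : L2Z) :
    Memℓp (fun p => (c p : ℂ) * ξ (σ p)) 2 := by
  have h := lp.memℓp ξ
  rw [memℓp_gen_iff (by norm_num)] at h ⊢
  simp only [norm_mul, Circle.norm_coe, one_mul]
  exact (σ.summable_iff (f := fun p => ‖ξ p‖ ^ (2 : ℝ≥0∞).toReal)).mpr h

/-- The unitary operator `ξ ↦ (p ↦ c(p) ξ(σ p))` on `ℓ²(ℤ × ℤ)`. -/
def weightedShift (σ : Equiv.Perm (ℤ × ℤ)) (c : ℤ × ℤ → Circle) : L2Z ≃ₗᵢ[ℂ] L2Z where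
  toFun ξ := ⟨fun p => (c p : ℂ) * ξ (σ p), weightedShift_memℓp σ c ξ⟩
  invFun ξ := ⟨fun p => (((c (σ.symm p))⁻¹ : Circle) : ℂ) * ξ (σ.symm p),
    weightedShift_memℓp σ.symm (fun p => (c (σ.symm p))⁻¹) ξ⟩
  map_add' ξ η := by ext p; exact mul_add _ _ _
  map_smul' a ξ := by ext p; simp [mul_left_comm]
  left_inv ξ := by ext p; simp
  right_inv ξ := by ext p; simp
  norm_map' ξ := by
    rw [lp.norm_eq_tsum_rpow (by norm_num), lp.norm_eq_tsum_rpow (by norm_num)]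
    congr 1
    have := σ.tsum_eq (fun p => ‖ξ p‖ ^ (2 : ℝ≥0∞).toReal)
    rw [← this]
    refine tsum_congr fun p => ?_
    simp [Circle.norm_coe]

theorem weightedShift_apply (σ : Equiv.Perm (ℤ × ℤ)) (c : ℤ × ℤ → Circle) (ξ : L2Z) (p : ℤ × ℤ) :
    weightedShift σ c ξ p = (c p : ℂ) * ξ (σ p) := rfl

/-- `(u ξ)(k, l) = ξ(k - 1, l)`, that is `u δ_{k,l} = δ_{k+1,l}`. -/
def regU : L2Z ≃ₗᵢ[ℂ] L2Z :=
  weightedShift ((Equiv.subRight (1 : ℤ)).prodCongr (Equiv.refl ℤ)) 1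

/-- `(v ξ)(k, l) = e^{-2πiαk} ξ(k, l - 1)`, that is `v δ_{k,l} = e^{-2πiαk} δ_{k,l+1}`. -/
def regV (α : ℝ) : L2Z ≃ₗᵢ[ℂ] L2Z :=
  weightedShift ((Equiv.refl ℤ).prodCongr (Equiv.subRight (1 : ℤ)))
    fun p => Circle.exp (-(2 * Real.pi * α * p.1))

theorem pair_reg (α : ℝ) : IsTorusPair α (regU : L2Z →L[ℂ] L2Z) (regV α : L2Z →L[ℂ] L2Z) where
  u_mem := (Unitary.linearIsometryEquiv.symm regU).2
  v_mem := (Unitary.linearIsometryEquiv.symm (regV α)).2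
  comm := by
    ext ξ p
    change regU (regV α ξ) p = Complex.exp _ * regV α (regU ξ) p
    simp only [regU, regV, weightedShift_apply]
    simp only [Circle.coe_exp, Pi.one_apply, Circle.coe_one, one_mul, ← mul_assoc,
      ← Complex.exp_add]
    change Complex.exp _ * ξ (p.1 - 1, p.2 - 1) = Complex.exp _ * ξ (p.1 - 1, p.2 - 1)
    congr 2
    simp
    ring

/-- The regular representation of the noncommutative torus on `ℓ²(ℤ × ℤ)`. -/
def regRep (α : ℝ) : NCTorus α →⋆ₐ[ℂ] (L2Z →L[ℂ] L2Z) := lift (pair_reg α)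

/-- The vector `δ_{0,0}` of `ℓ²(ℤ × ℤ)`. -/
def vac : L2Z := lp.single 2 (0, 0) (1 : ℂ)

/-- The canonical trace `τ(x) = ⟨δ_{0,0}, x δ_{0,0}⟩` of the noncommutative torus; by
`trace_monomial` it satisfies `τ(U^m V^n) = δ_{m,0} δ_{n,0}`. -/
def trace (α : ℝ) : NCTorus α →L[ℂ] ℂ where
  toFun x := ⟪vac, regRep α x vac⟫_ℂ
  map_add' x y := by simp
  map_smul' c x := by simp
  cont := by
    have := continuous_starAlgHom (regRep α)
    fun_prop

/-- The first generator as a unitary. -/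
def unitaryU (α : ℝ) : unitary (NCTorus α) := ⟨U α, (pair_UV α).u_mem⟩

/-- The second generator as a unitary. -/
def unitaryV (α : ℝ) : unitary (NCTorus α) := ⟨V α, (pair_UV α).v_mem⟩

theorem regU_zpow (m : ℤ) (ξ : L2Z) (p : ℤ × ℤ) : (regU ^ m) ξ p = ξ (p.1 - m, p.2) := by
  induction m generalizing ξ with
  | zero => simp
  | succ m ih =>
    rw [zpow_add_one]
    change (regU ^ (m : ℤ)) (regU ξ) p = _
    rw [ih]
    change ((1 : Circle) : ℂ) * ξ (p.1 - m - 1, p.2) = _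
    simp [sub_sub]
  | pred m ih =>
    obtain ⟨η, rfl⟩ := regU.surjective ξ
    rw [zpow_sub_one]
    change (regU ^ (-m : ℤ)) (regU.symm (regU η)) p = _
    rw [LinearIsometryEquiv.symm_apply_apply, ih]
    change _ = ((1 : Circle) : ℂ) * η (p.1 - (-m - 1) - 1, p.2)
    rw [Circle.coe_one, one_mul, show p.1 - (-(m : ℤ) - 1) - 1 = p.1 - -m by ring]

theorem regV_zpow (α : ℝ) (n : ℤ) (ξ : L2Z) (p : ℤ × ℤ) :
    (regV α ^ n) ξ p = (Circle.exp (-(2 * Real.pi * α * p.1)) ^ n : Circle) * ξ (p.1, p.2 - n) := by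
  induction n generalizing ξ with
  | zero => simp
  | succ m ih =>
    rw [zpow_add_one]
    change (regV α ^ (m : ℤ)) (regV α ξ) p = _
    rw [ih]
    change _ * ((Circle.exp (-(2 * Real.pi * α * p.1)) : ℂ) * ξ (p.1, p.2 - m - 1)) = _
    rw [zpow_add_one, sub_sub, Circle.coe_mul, ← mul_assoc]
  | pred m ih =>
    obtain ⟨η, rfl⟩ := (regV α).surjective ξ
    rw [zpow_sub_one]
    change (regV α ^ (-m : ℤ)) ((regV α).symm (regV α η)) p = _
    rw [LinearIsometryEquiv.symm_apply_apply, ih]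
    change _ = _ * ((Circle.exp (-(2 * Real.pi * α * p.1)) : ℂ) * η (p.1, p.2 - (-m - 1) - 1))
    rw [← mul_assoc, ← Circle.coe_mul, zpow_sub_one, inv_mul_cancel_right,
      show p.2 - (-(m : ℤ) - 1) - 1 = p.2 - -m by ring]

theorem regRep_monomial (α : ℝ) (m n : ℤ) (ξ : L2Z) :
    regRep α ((unitaryU α ^ m * unitaryV α ^ n : unitary (NCTorus α)) : NCTorus α) ξ
      = (regU ^ m) ((regV α ^ n) ξ) := by
  have hU : Unitary.map (StarMonoidHom.ofClass (regRep α)) (unitaryU α) = Unitary.linearIsometryEquiv.symm regU :=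
    Subtype.ext (lift_U (pair_reg α))
  have hV : Unitary.map (StarMonoidHom.ofClass (regRep α)) (unitaryV α) = Unitary.linearIsometryEquiv.symm (regV α) :=
    Subtype.ext (lift_V (pair_reg α))
  have h : Unitary.map (StarMonoidHom.ofClass (regRep α)) (unitaryU α ^ m * unitaryV α ^ n)
      = Unitary.linearIsometryEquiv.symm (regU ^ m * regV α ^ n) := by
    rw [map_mul, map_zpow, map_zpow, hU, hV, map_mul, map_zpow, map_zpow]
  exact DFunLike.congr_fun (congrArg Subtype.val h) ξ

theorem trace_monomial (α : ℝ) (m n : ℤ) :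
    trace α ((unitaryU α ^ m * unitaryV α ^ n : unitary (NCTorus α)) : NCTorus α)
      = if m = 0 ∧ n = 0 then 1 else 0 := by
  change ⟪vac, regRep α _ vac⟫_ℂ = _
  rw [regRep_monomial, vac, lp.inner_single_left, regU_zpow, regV_zpow]
  rcases eq_or_ne m 0 with rfl | hm <;> rcases eq_or_ne n 0 with rfl | hn <;>
    simp [lp.single_apply, *]

/-! ### The Anzai skew-product -/

/-- The rotation `R_β z = e^{2πiβ} z` of the unit circle. -/
def rotation (β : ℝ) (z : Circle) : Circle := Circle.exp (2 * Real.pi * β) * z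

/-- Extension by zero of a circle-valued function on the circle to the complex plane. -/
def extendCircle (f : C(Circle, Circle)) : ℂ → ℂ :=
  Function.extend ((↑) : Circle → ℂ) (fun z => (f z : ℂ)) 0

theorem extendCircle_coe (f : C(Circle, Circle)) (z : Circle) : extendCircle f z = f z :=
  Circle.coe_injective.extend_apply _ _ _

theorem extendCircle_continuousOn (f : C(Circle, Circle)) :
    ContinuousOn (extendCircle f) (unitary ℂ : Set ℂ) := by
  rw [continuousOn_iff_continuous_domRestrict]
  have h : ∀ z : (unitary ℂ : Set ℂ), ‖(z : ℂ)‖ = 1 := fun z => CStarRing.norm_of_mem_unitary z.2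
  have hc : Continuous fun z : (unitary ℂ : Set ℂ) =>
      (f ⟨z, mem_sphere_zero_iff_norm.mpr (h z)⟩ : ℂ) := by
    refine continuous_induced_dom.comp (f.continuous.comp ?_)
    exact Continuous.subtype_mk continuous_subtype_val _
  convert hc using 2 with z
  exact extendCircle_coe f ⟨z, _⟩

/-- The unitary `f(u)` obtained from a unitary `u` of a C⋆-algebra and a continuous
`f : 𝕋 → 𝕋` by the continuous functional calculus. -/
def circleCalc {B : Type*} [CStarAlgebra B] (f : C(Circle, Circle)) (u : B) : B :=
  cfc (extendCircle f) u

theorem circleCalc_mem {B : Type*} [CStarAlgebra B] (f : C(Circle, Circle)) {u : B}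
    (hu : u ∈ unitary B) : circleCalc f u ∈ unitary B := by
  have hs := spectrum_subset_unitary_of_mem_unitary hu
  have hn := isStarNormal_of_mem_unitary hu
  rw [circleCalc, cfc_unitary_iff _ _ hn ((extendCircle_continuousOn f).mono hs)]
  intro z hz
  have h : ‖z‖ = 1 := CStarRing.norm_of_mem_unitary (hs hz)
  have := extendCircle_coe f ⟨z, mem_sphere_zero_iff_norm.mpr h⟩
  change extendCircle f z = _ at this
  rw [this]
  rw [Complex.star_def, ← Complex.normSq_eq_conj_mul_self, Circle.normSq_coe, Complex.ofReal_one]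

theorem circleCalc_commute {B : Type*} [CStarAlgebra B] (f : C(Circle, Circle)) (u : B) :
    Commute u (circleCalc f u) := by
  by_cases hu : IsStarNormal u
  · have := cfc_commute_cfc (fun z : ℂ => z) (extendCircle f) u
    rwa [cfc_id' ℂ u] at this
  · rw [circleCalc, cfc_apply_of_not_predicate u hu]
    exact Commute.zero_right u

theorem pair_anzai (α θ : ℝ) (f : C(Circle, Circle)) :
    IsTorusPair α ((Circle.exp θ : ℂ) • U α) (circleCalc f (U α) * V α) where
  u_mem := by
    have hU := Unitary.mem_iff.mp (pair_UV α).u_mem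
    have hz : conj (Circle.exp θ : ℂ) * Circle.exp θ = 1 := by
      rw [← Complex.normSq_eq_conj_mul_self, Circle.normSq_coe, Complex.ofReal_one]
    rw [Unitary.mem_iff, star_smul, smul_mul_smul_comm, smul_mul_smul_comm, hU.1, hU.2,
      Complex.star_def, mul_comm (Circle.exp θ : ℂ), hz, one_smul]
    exact ⟨rfl, rfl⟩
  v_mem := mul_mem (circleCalc_mem f (pair_UV α).u_mem) (pair_UV α).v_mem
  comm := by
    have hc := (circleCalc_commute f (U α)).eq
    rw [smul_mul_assoc, ← mul_assoc, hc, mul_assoc, (pair_UV α).comm]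
    simp only [mul_smul_comm, mul_assoc]
    rw [smul_comm]

/-- The ⋆-endomorphism of `𝔸_α` with `U ↦ e^{iθ} U` and `V ↦ f(U) V`. -/
def anzaiHom (α θ : ℝ) (f : C(Circle, Circle)) : NCTorus α →⋆ₐ[ℂ] NCTorus α :=
  lift (pair_anzai α θ f)

/-- The function `z ↦ conj (f (e^{-iθ} z))`. -/
def anzaiInv (θ : ℝ) (f : C(Circle, Circle)) : C(Circle, Circle) where
  toFun z := (f (Circle.exp (-θ) * z))⁻¹

theorem anzaiHom_comp (α θ θ' : ℝ) (f f' : C(Circle, Circle)) (hθ : θ' = -θ)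
    (hf : ∀ z, f' (Circle.exp θ * z) * f z = 1) :
    (anzaiHom α θ f).comp (anzaiHom α θ' f') = StarAlgHom.id ℂ _ := by
  subst hθ
  have hU := (pair_UV α).u_mem
  have hs := spectrum_subset_unitary_of_mem_unitary hU
  have hn := isStarNormal_of_mem_unitary hU
  have hu : anzaiHom α θ f (U α) = (Circle.exp θ : ℂ) • U α := lift_U _
  have hv : anzaiHom α θ f (V α) = circleCalc f (U α) * V α := lift_V _
  have hu' : anzaiHom α (-θ) f' (U α) = (Circle.exp (-θ) : ℂ) • U α := lift_U _
  have hv' : anzaiHom α (-θ) f' (V α) = circleCalc f' (U α) * V α := lift_V _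
  have hcU : (Circle.exp θ : ℂ) • U α ∈ unitary (NCTorus α) := (pair_anzai α θ f).u_mem
  have hcn := isStarNormal_of_mem_unitary hcU
  have hmul : ∀ z ∈ spectrum ℂ (U α), (Circle.exp θ : ℂ) * z ∈ unitary ℂ := fun z hz =>
    mul_mem (by
      rw [Unitary.mem_iff_star_mul_self, Complex.star_def, ← Complex.normSq_eq_conj_mul_self,
        Circle.normSq_coe, Complex.ofReal_one]) (hs hz)
  have hc1 : ContinuousOn (extendCircle f') (((Circle.exp θ : ℂ) * ·) '' spectrum ℂ (U α)) :=
    (extendCircle_continuousOn f').mono (by rintro _ ⟨z, hz, rfl⟩; exact hmul z hz)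
  have hc2 : ContinuousOn (fun z => extendCircle f' ((Circle.exp θ : ℂ) * z))
      (spectrum ℂ (U α)) :=
    hc1.comp (by fun_prop) fun z hz => ⟨z, hz, rfl⟩
  have hc3 := (extendCircle_continuousOn f).mono hs
  refine hom_ext ?_ ?_
  · change anzaiHom α θ f (anzaiHom α (-θ) f' (U α)) = U α
    rw [hu', map_smul, hu, smul_smul, ← Circle.coe_mul, ← Circle.exp_add]
    simp
  · have hmap : anzaiHom α θ f (circleCalc f' (U α)) = circleCalc f' ((Circle.exp θ : ℂ) • U α) := by
      rw [circleCalc, StarAlgHom.map_cfc (anzaiHom α θ f) (extendCircle f') (U α)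
        ((extendCircle_continuousOn f').mono hs) (continuous_starAlgHom _) hn
        (by rw [hu]; exact hcn), hu, circleCalc]
    have hone : circleCalc f' ((Circle.exp θ : ℂ) • U α) * circleCalc f (U α) = 1 := by
      rw [circleCalc, circleCalc, ← cfc_comp_const_mul _ _ _ hc1 hn, ← cfc_mul _ _ _ hc2 hc3,
        ← cfc_one ℂ (U α) hn]
      refine cfc_congr fun z hz => ?_
      have h : ‖z‖ = 1 := CStarRing.norm_of_mem_unitary (hs hz)
      obtain ⟨w, rfl⟩ : ∃ w : Circle, (w : ℂ) = z := ⟨⟨z, mem_sphere_zero_iff_norm.mpr h⟩, rfl⟩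
      change extendCircle f' ((Circle.exp θ : ℂ) * w) * extendCircle f w = 1
      rw [← Circle.coe_mul, extendCircle_coe, extendCircle_coe, ← Circle.coe_mul, hf,
        Circle.coe_one]
    change anzaiHom α θ f (anzaiHom α (-θ) f' (V α)) = V α
    rw [hv', map_mul, hmap, hv, ← mul_assoc, hone, one_mul]

/-- The Anzai skew-product `Φ_{θ,f}`: the ⋆-automorphism of `𝔸_α` with `U ↦ e^{iθ} U` and
`V ↦ f(U) V`. -/
def anzai (α θ : ℝ) (f : C(Circle, Circle)) : NCTorus α ≃⋆ₐ[ℂ] NCTorus α :=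
  StarAlgEquiv.ofStarAlgHom (anzaiHom α θ f) (anzaiHom α (-θ) (anzaiInv θ f))
    (anzaiHom_comp α (-θ) θ (anzaiInv θ f) f (by simp) fun z => by simp [anzaiInv])
    (anzaiHom_comp α θ (-θ) f (anzaiInv θ f) rfl fun z => by simp [anzaiInv])

theorem anzai_U (α θ : ℝ) (f : C(Circle, Circle)) :
    anzai α θ f (U α) = (Circle.exp θ : ℂ) • U α := lift_U _

theorem anzai_V (α θ : ℝ) (f : C(Circle, Circle)) :
    anzai α θ f (V α) = circleCalc f (U α) * V α := lift_V _

/-- The twisted cocycle product `f_n`. -/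
def cocycle (α : ℝ) (f : C(Circle, Circle)) (n : ℤ) (z : Circle) : ℂ :=
  if 0 ≤ n then ∏ l ∈ Finset.range n.natAbs, (f (rotation (-(l * α)) z) : ℂ)
  else ∏ l ∈ Finset.Icc 1 n.natAbs, conj (f (rotation (l * α) z) : ℂ)

end NCTorus

/-! ### Ergodic states of C⋆-dynamical systems -/

/-- A state of a unital C⋆-algebra. -/
def IsState {A : Type*} [CStarAlgebra A] (φ : A →L[ℂ] ℂ) : Prop :=
  φ 1 = 1 ∧ ∀ a : A, 0 ≤ φ (star a * a)

/-- The convex set of states invariant under a ⋆-automorphism. -/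
def invariantStates {A : Type*} [CStarAlgebra A] (γ : A ≃⋆ₐ[ℂ] A) : Set (A →L[ℂ] ℂ) :=
  {φ | IsState φ ∧ ∀ a : A, φ (γ a) = φ a}

/-- The C⋆-dynamical system `(A, γ, φ)` is ergodic: `φ` is an extreme point of the convex set of
`γ`-invariant states. -/
def IsErgodicSystem {A : Type*} [CStarAlgebra A] (γ : A ≃⋆ₐ[ℂ] A) (φ : A →L[ℂ] ℂ) : Prop :=
  φ ∈ Set.extremePoints ℝ (invariantStates γ)

/-! ### The circle as a measure space -/

instance : MeasurableSpace Circle := borel Circle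

instance : BorelSpace Circle := ⟨rfl⟩

/-- The normalised Lebesgue (Haar) probability measure `dz/(2πiz)` on the unit circle, the image of
`dt` on `ℝ/ℤ` under `t ↦ e^{2πit}`. -/
def circleMeasure : MeasureTheory.Measure Circle :=
  MeasureTheory.Measure.map (AddCircle.toCircle : UnitAddCircle → Circle) AddCircle.haarAddCircle

instance : MeasureTheory.IsProbabilityMeasure circleMeasure :=
  MeasureTheory.Measure.isProbabilityMeasure_map AddCircle.continuous_toCircle.aemeasurable

end

noncomputable section

open MeasureTheory

/-! The elements `h(U) Vⁿ` span a dense subspace of the torus, and the automorphism preserves each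
row `n`: it sends `h(U) Vⁿ` to `((h ∘ R) f_n)(U) Vⁿ`, where `R` is the rotation by `θ/2π`
(`anzai_calcU_mul_powV`). For the trace, each row is an isometric copy of `L²(𝕋)`
(`trace_star_calcUV`). Hence an invariant functional that is `L²`-bounded on row `n` is represented
there by some `g` in `L²`. Since `f_n` is unimodular, its invariance on that row is exactly the
cohomological equation for `g` (`inner_twisted_of_solution`, `solution_of_inner_twisted`).

Absence of solutions gives ergodicity: if `τ = aφ + bψ` with `a, b > 0`, then `φ ≤ a⁻¹τ` on positive
elements, so Cauchy–Schwarz and Riesz produce such a `g` on every row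
(`exists_inner_eq_of_dominated`). It vanishes for `n ≠ 0`, so `φ` does too on those rows. On row `0`
the power `Uᵐ` with `m ≠ 0` is an eigenvector with eigenvalue `e^{imθ} ≠ 1`, which forces `φ(Uᵐ) =
0`. Thus `φ = τ` (`eq_trace_of_dominated`).

Conversely, let `g ≠ 0` be a solution for some `n ≠ 0`. Its modulus is invariant under an ergodic
rotation, so `g` may be scaled to modulus one. Placing its Fourier coefficients on row `n` of `ℓ²(ℤ
× ℤ)` gives a unit vector `ξ` orthogonal to `δ = δ_{0,0}`, whose vector state is again `τ`
(`coefficient_rowVector_self`). The vector states of `(δ ± ξ)/√2` are invariant and have average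
`τ`. They differ from `τ` by a cross term that recovers the Fourier coefficients of `g`, so `τ` is
not extreme. -/

/-! ### Continuous functions on `ℝ/ℤ`, characters and translations. -/

/-- Continuous linear maps on `C(ℝ/ℤ, ℂ)` are determined by their values on the characters. -/
theorem ContinuousMap.clm_ext_fourier {E : Type*} [NormedAddCommGroup E] [NormedSpace ℂ E]
    {F G : C(UnitAddCircle, ℂ) →L[ℂ] E} (h : ∀ m : ℤ, F (fourier m) = G (fourier m)) : F = G := by
  refine ContinuousLinearMap.ext_on (s := Set.range (@fourier 1)) ?_ ?_
  · rw [dense_iff_closure_eq, ← Submodule.topologicalClosure_coe, span_fourier_closure_eq_top]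
    rfl
  · rintro _ ⟨m, rfl⟩
    exact h m

/-- A ⋆-homomorphism of C⋆-algebras as a continuous linear map. -/
def StarAlgHom.toCLM {A B : Type*} [CStarAlgebra A] [CStarAlgebra B] (φ : A →⋆ₐ[ℂ] B) :
    A →L[ℂ] B where
  toLinearMap := φ.toAlgHom.toLinearMap
  cont := NCTorus.continuous_starAlgHom φ

@[simp]
theorem StarAlgHom.toCLM_apply {A B : Type*} [CStarAlgebra A] [CStarAlgebra B]
    (φ : A →⋆ₐ[ℂ] B) (a : A) : φ.toCLM a = φ a := rfl

/-- Translation of continuous functions on `ℝ/ℤ`. -/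
def translation (a : UnitAddCircle) : C(UnitAddCircle, ℂ) →⋆ₐ[ℂ] C(UnitAddCircle, ℂ) :=
  ContinuousMap.compStarAlgHom' ℂ ℂ (ContinuousMap.addRight a)

@[simp]
theorem translation_apply (a : UnitAddCircle) (h : C(UnitAddCircle, ℂ)) (x : UnitAddCircle) :
    translation a h x = h (x + a) := rfl

theorem translation_fourier (a : UnitAddCircle) (m : ℤ) :
    translation a (fourier m) = fourier m a • (fourier m : C(UnitAddCircle, ℂ)) := by
  ext x
  change fourier m (x + a) = fourier m a * fourier m x
  rw [fourier_apply, fourier_apply, fourier_apply, smul_add, AddCircle.toCircle_add,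
    Circle.coe_mul, mul_comm]

/-- The homeomorphism of `ℝ/ℤ` with the unit circle. -/
def circleHomeo : UnitAddCircle ≃ₜ Circle := AddCircle.homeomorphCircle one_ne_zero

@[simp]
theorem circleHomeo_apply (x : UnitAddCircle) : circleHomeo x = AddCircle.toCircle x :=
  AddCircle.homeomorphCircle_apply _ _

theorem rotation_toCircle (β : ℝ) (x : UnitAddCircle) :
    NCTorus.rotation β (AddCircle.toCircle x) = AddCircle.toCircle (x + (β : UnitAddCircle)) := by
  rw [AddCircle.toCircle_add, AddCircle.toCircle_apply_mk, NCTorus.rotation, mul_comm, div_one]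

/-- A circle-valued function, read as a complex function on `ℝ/ℤ`. -/
def circlePullback (f : C(Circle, Circle)) : C(UnitAddCircle, ℂ) where
  toFun x := (f (AddCircle.toCircle x) : ℂ)
  continuous_toFun := by
    have := AddCircle.continuous_toCircle (T := (1 : ℝ))
    fun_prop

/-! ### Functional calculus of `U` and its commutation with powers of `V`. -/

namespace NCTorus

variable (α : ℝ)

/-- The spectrum of the first generator, seen inside `ℝ/ℤ`. -/
def spectrumToCircle : C(spectrum ℂ (U α), UnitAddCircle) where
  toFun z := circleHomeo.symm ⟨z, mem_sphere_zero_iff_norm.mpr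
    (CStarRing.norm_of_mem_unitary (spectrum_subset_unitary_of_mem_unitary (pair_UV α).u_mem z.2))⟩
  continuous_toFun := circleHomeo.symm.continuous.comp
    (Continuous.subtype_mk continuous_subtype_val _)

theorem toCircle_spectrumToCircle (z : spectrum ℂ (U α)) :
    (AddCircle.toCircle (spectrumToCircle α z) : ℂ) = z := by
  rw [← circleHomeo_apply]
  exact congrArg Subtype.val (circleHomeo.apply_symm_apply _)

theorem isStarNormal_U : IsStarNormal (U α) := isStarNormal_of_mem_unitary (pair_UV α).u_mem

/-- The functional calculus `h ↦ h(U)` of the first generator, on functions on `ℝ/ℤ`. -/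
def calcU : C(UnitAddCircle, ℂ) →⋆ₐ[ℂ] NCTorus α :=
  (cfcHom (isStarNormal_U α)).comp
    (ContinuousMap.compStarAlgHom' ℂ ℂ (spectrumToCircle α))

theorem calcU_fourier_one : calcU α (fourier 1) = U α := by
  refine Eq.trans ?_ (cfcHom_id (R := ℂ) (isStarNormal_U α))
  refine congrArg (cfcHom (isStarNormal_U α)) ?_
  ext z
  simpa [fourier_apply] using toCircle_spectrumToCircle α z

theorem calcU_circlePullback (f : C(Circle, Circle)) :
    calcU α (circlePullback f) = circleCalc f (U α) := by
  have hs := spectrum_subset_unitary_of_mem_unitary (pair_UV α).u_mem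
  rw [circleCalc, cfc_apply _ _ (isStarNormal_U α) ((extendCircle_continuousOn f).mono hs)]
  refine congrArg (cfcHom (isStarNormal_U α)) ?_
  ext z
  change (f (AddCircle.toCircle (spectrumToCircle α z)) : ℂ) = extendCircle f z
  rw [← extendCircle_coe, toCircle_spectrumToCircle]

theorem map_fourier {A : Type*} [CStarAlgebra A] (Θ : C(UnitAddCircle, ℂ) →⋆ₐ[ℂ] A)
    (u : unitary A) (hu : Θ (fourier 1) = u) (m : ℤ) : Θ (fourier m) = (u ^ m : unitary A) := by
  have key : ∀ m : ℤ, Θ (fourier (m + 1)) = Θ (fourier m) * u := fun m => by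
    rw [← hu, ← map_mul]
    congr 1
    ext x
    exact fourier_add
  induction m with
  | zero =>
    rw [zpow_zero, OneMemClass.coe_one, ← map_one Θ]
    congr 1
    ext x
    exact fourier_zero
  | succ m ih => rw [key, ih, zpow_add_one]; rfl
  | pred m ih =>
    have h := key (-m - 1)
    rw [sub_add_cancel, ih] at h
    rw [zpow_sub_one, Submonoid.coe_mul, h, mul_assoc, ← Submonoid.coe_mul, mul_inv_cancel,
      OneMemClass.coe_one, mul_one]

theorem calcU_fourier (m : ℤ) : calcU α (fourier m) = (unitaryU α ^ m : unitary (NCTorus α)) :=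
  map_fourier (calcU α) (unitaryU α) (calcU_fourier_one α) m

/-- ⋆-homomorphisms on `C(ℝ/ℤ, ℂ)` are determined by their value on the basic character. -/
theorem hom_ext_fourier {A : Type*} [CStarAlgebra A] {Θ Ξ : C(UnitAddCircle, ℂ) →⋆ₐ[ℂ] A}
    (u : unitary A) (h : Θ (fourier 1) = u) (h' : Ξ (fourier 1) = u) : Θ = Ξ := by
  have : Θ.toCLM = Ξ.toCLM := ContinuousMap.clm_ext_fourier fun m => by
    simp only [StarAlgHom.toCLM_apply, map_fourier Θ u h, map_fourier Ξ u h']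
  ext h
  exact DFunLike.congr_fun this h

theorem mul_V_cancel {a b : NCTorus α} (h : a * V α = b * V α) : a = b :=
  (Unitary.toUnits (unitaryV α)).isUnit.mul_right_cancel h

/-- Conjugation by `V` composed with the calculus of `U` is a ⋆-homomorphism on `C(ℝ/ℤ)`, so it is
fixed by its value on the basic character. There the claim is the defining relation of the torus. -/
theorem V_mul_calcU (h : C(UnitAddCircle, ℂ)) :
    V α * calcU α h = calcU α (translation (-(α : UnitAddCircle)) h) * V α := by
  have hVV : star (V α) * V α = 1 := (Unitary.mem_iff.mp (pair_UV α).v_mem).1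
  have hVV' : V α * star (V α) = 1 := (Unitary.mem_iff.mp (pair_UV α).v_mem).2
  let Θ : C(UnitAddCircle, ℂ) →⋆ₐ[ℂ] NCTorus α :=
    ((Unitary.conjStarAlgAut ℂ (NCTorus α) (unitaryV α) : NCTorus α ≃⋆ₐ[ℂ] NCTorus α) :
      NCTorus α →⋆ₐ[ℂ] NCTorus α).comp (calcU α)
  have hΘ : ∀ h, Θ h = V α * calcU α h * star (V α) := fun h => rfl
  have hext : Θ = (calcU α).comp (translation (-(α : UnitAddCircle))) := by
    refine hom_ext_fourier (unitaryV α * unitaryU α * (unitaryV α)⁻¹) ?_ ?_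
    · rw [hΘ, calcU_fourier_one]
      rfl
    · change calcU α (translation _ (fourier 1)) = V α * U α * star (V α)
      rw [translation_fourier, map_smul, calcU_fourier_one]
      have h1 : V α * U α = (fourier 1 (-(α : UnitAddCircle)) : ℂ) • (U α * V α) := by
        rw [(pair_UV α).comm, smul_smul, ← AddCircle.coe_neg, fourier_coe_apply, ← Complex.exp_add]
        simp
      rw [h1, smul_mul_assoc, mul_assoc, hVV', mul_one]
  have h2 : calcU α (translation (-(α : UnitAddCircle)) h) = V α * calcU α h * star (V α) :=
    (DFunLike.congr_fun hext h).symm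
  rw [h2, mul_assoc, hVV, mul_one]

/-- Integer powers of the second generator. -/
def powV (n : ℤ) : NCTorus α := (unitaryV α ^ n : unitary (NCTorus α))

theorem powV_zero : powV α 0 = 1 := rfl

theorem powV_add_one (n : ℤ) : powV α (n + 1) = powV α n * V α := by
  rw [powV, zpow_add_one]
  rfl

theorem star_powV (n : ℤ) : star (powV α n) = powV α (-n) := by
  rw [powV, powV, zpow_neg]
  rfl

theorem powV_mul_calcU (n : ℤ) (h : C(UnitAddCircle, ℂ)) :
    powV α n * calcU α h = calcU α (translation (-(n • (α : UnitAddCircle))) h) * powV α n := by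
  induction n generalizing h with
  | zero =>
    rw [powV_zero, one_mul, mul_one]
    congr 1
    ext x
    simp
  | succ n ih =>
    rw [powV_add_one, mul_assoc, V_mul_calcU, ← mul_assoc, ih, mul_assoc]
    congr 2
    ext x
    simp only [translation_apply]
    congr 1
    rw [add_smul, one_smul]
    abel
  | pred n ih =>
    -- Downward step: after multiplying on the right by `V`, the product `h(U) V` is rewritten as
    -- `V` times the calculus of a translate of `h`, which brings the exponent back to the known
    -- case.
    apply mul_V_cancel
    have h1 := V_mul_calcU α (translation (α : UnitAddCircle) h)
    have h2 : translation (-(α : UnitAddCircle)) (translation (α : UnitAddCircle) h) = h := by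
      ext x
      simp
    have h3 := powV_add_one α (-n - 1)
    rw [sub_add_cancel] at h3
    rw [h2] at h1
    rw [mul_assoc, ← h1, ← mul_assoc, ← h3, ih, mul_assoc, ← h3]
    congr 2
    ext x
    simp only [translation_apply]
    congr 1
    rw [sub_smul, one_smul]
    abel

/-! ### The automorphism on `h(U) Vⁿ` and the cocycle recursion. -/

variable (θ : ℝ) (f : C(Circle, Circle))

theorem anzai_calcU (h : C(UnitAddCircle, ℂ)) :
    anzai α θ f (calcU α h) =
      calcU α (translation ((θ / (2 * Real.pi) : ℝ) : UnitAddCircle) h) := by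
  have hext : ((anzai α θ f : NCTorus α ≃⋆ₐ[ℂ] NCTorus α) : NCTorus α →⋆ₐ[ℂ] NCTorus α).comp
      (calcU α) = (calcU α).comp (translation ((θ / (2 * Real.pi) : ℝ) : UnitAddCircle)) := by
    refine hom_ext_fourier ⟨_, (pair_anzai α θ f).u_mem⟩ ?_ ?_
    · change anzai α θ f (calcU α (fourier 1)) = _
      rw [calcU_fourier_one, anzai_U]
    · change calcU α (translation _ (fourier 1)) = _
      rw [translation_fourier, map_smul, calcU_fourier_one]
      congr 1
      rw [fourier_one, AddCircle.toCircle_apply_mk]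
      congr 2
      field_simp
  exact DFunLike.congr_fun hext h

theorem cocycle_zero (z : Circle) : cocycle α f 0 z = 1 := by simp [cocycle]

/-- The index ranges starting at `0` for positive `n` and at `1` for negative `n` make one recursion
valid on all of `ℤ`. For negative `n` the new factor cancels the last conjugate because `f` is
unimodular. -/
theorem cocycle_add_one (n : ℤ) (z : Circle) :
    cocycle α f (n + 1) z = cocycle α f n z * f (rotation (-(n * α)) z) := by
  rcases le_or_gt 0 n with hn | hn
  · lift n to ℕ using hn
    rw [cocycle, cocycle, if_pos (by positivity), if_pos (by positivity)]
    rw [show ((n : ℤ) + 1).natAbs = n + 1 by omega, Finset.prod_range_succ]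
    simp
  · obtain ⟨k, rfl⟩ : ∃ k : ℕ, n = -(k : ℤ) - 1 := ⟨(-n - 1).toNat, by omega⟩
    have hc : ∀ w : Circle, conj (w : ℂ) * w = 1 := fun w => by
      rw [← Complex.normSq_eq_conj_mul_self, Circle.normSq_coe, Complex.ofReal_one]
    have h1 : cocycle α f (-(k : ℤ) - 1) z =
        ∏ l ∈ Finset.Icc 1 (k + 1), conj (f (rotation (l * α) z) : ℂ) := by
      rw [cocycle, if_neg (by omega), show (-(k : ℤ) - 1).natAbs = k + 1 by omega]
    have h2 : cocycle α f (-(k : ℤ) - 1 + 1) z =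
        ∏ l ∈ Finset.Icc 1 k, conj (f (rotation (l * α) z) : ℂ) := by
      rw [sub_add_cancel]
      -- At `k = 0` the index `n + 1` is `0`, which falls in the nonnegative branch of the
      -- definition; both products are then empty.
      rcases Nat.eq_zero_or_pos k with rfl | hk
      · simp [cocycle]
      · rw [cocycle, if_neg (by omega), show (-(k : ℤ)).natAbs = k by omega]
    rw [h1, h2, Finset.prod_Icc_succ_top (by omega), mul_assoc]
    have h3 : (-(((-(k : ℤ) - 1 : ℤ) : ℝ) * α)) = ((k + 1 : ℕ) : ℝ) * α := by
      push_cast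
      ring
    rw [h3, hc, mul_one]

theorem norm_cocycle (n : ℤ) (z : Circle) : ‖cocycle α f n z‖ = 1 := by
  unfold cocycle
  split_ifs <;> simp [norm_prod, Circle.norm_coe]

theorem continuous_cocycle (n : ℤ) : Continuous (cocycle α f n) := by
  have h : ∀ β : ℝ, Continuous (rotation β) := fun β => continuous_const.mul continuous_id
  unfold cocycle
  split_ifs
  · exact continuous_finsetProd _ fun l _ =>
      continuous_induced_dom.comp (f.continuous.comp (h _))
  · exact continuous_finsetProd _ fun l _ =>
      Complex.continuous_conj.comp (continuous_induced_dom.comp (f.continuous.comp (h _)))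

/-- The twisted cocycle product `f_n` as a function on `ℝ/ℤ`. -/
def cocycleFun (n : ℤ) : C(UnitAddCircle, ℂ) where
  toFun x := cocycle α f n (AddCircle.toCircle x)
  continuous_toFun := (continuous_cocycle α f n).comp AddCircle.continuous_toCircle

theorem cocycleFun_apply (n : ℤ) (x : UnitAddCircle) :
    cocycleFun α f n x = cocycle α f n (AddCircle.toCircle x) := rfl

theorem conj_cocycleFun_mul_self (n : ℤ) (x : UnitAddCircle) :
    conj (cocycleFun α f n x) * cocycleFun α f n x = 1 := by
  rw [← Complex.normSq_eq_conj_mul_self, Complex.normSq_eq_norm_sq, cocycleFun_apply, norm_cocycle]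
  simp

theorem cocycleFun_zero : cocycleFun α f 0 = 1 := by
  ext x
  exact cocycle_zero α f (AddCircle.toCircle x)

theorem cocycleFun_add_one (n : ℤ) : cocycleFun α f (n + 1) =
    cocycleFun α f n * translation (-(n • (α : UnitAddCircle))) (circlePullback f) := by
  ext x
  have := cocycle_add_one α f n (AddCircle.toCircle x)
  rw [rotation_toCircle] at this
  rw [cocycleFun_apply, this, ← AddCircle.coe_zsmul, zsmul_eq_mul, ← AddCircle.coe_neg]
  rfl

/-- Both sides gain the same right factor, the image of `V`, when `n` increases by one, and they
agree at `0`. That factor is invertible, so the induction also runs downwards. -/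
theorem anzai_powV (n : ℤ) :
    anzai α θ f (powV α n) = calcU α (cocycleFun α f n) * powV α n := by
  have key : ∀ n : ℤ, calcU α (cocycleFun α f (n + 1)) * powV α (n + 1) =
      calcU α (cocycleFun α f n) * powV α n * anzai α θ f (V α) := fun n => by
    rw [anzai_V, ← calcU_circlePullback, mul_assoc, ← mul_assoc (powV α n), powV_mul_calcU,
      cocycleFun_add_one, map_mul, powV_add_one]
    simp only [mul_assoc]
  induction n with
  | zero => rw [cocycleFun_zero, powV_zero, map_one, map_one, mul_one]
  | succ n ih => rw [key, ← ih, powV_add_one, map_mul]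
  | pred n ih =>
    have h1 := key (-n - 1)
    have h2 := powV_add_one α (-n - 1)
    rw [sub_add_cancel] at h1 h2
    rw [← ih, h2, map_mul] at h1
    have hu : IsUnit (anzai α θ f (V α)) :=
      ((Unitary.toUnits (unitaryV α)).isUnit).map (anzai α θ f : NCTorus α →* NCTorus α)
    exact hu.mul_right_cancel h1

theorem anzai_calcU_mul_powV (h : C(UnitAddCircle, ℂ)) (n : ℤ) :
    anzai α θ f (calcU α h * powV α n) =
      calcU α (translation ((θ / (2 * Real.pi) : ℝ) : UnitAddCircle) h * cocycleFun α f n) *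
        powV α n := by
  rw [map_mul, anzai_calcU, anzai_powV, map_mul, mul_assoc]

end NCTorus

/-! ### Haar integration and irrational rotations of `ℝ/ℤ`. -/

theorem integral_fourier (m : ℤ) :
    ∫ x : UnitAddCircle, fourier m x ∂AddCircle.haarAddCircle = if m = 0 then 1 else 0 := by
  have h := congrFun (fourierCoeff_fourier (T := 1) m) 0
  simpa [fourierCoeff, Pi.single_apply, eq_comm] using h

/-- Integration over `ℝ/ℤ` as a continuous linear functional. -/
def integralCLM : C(UnitAddCircle, ℂ) →L[ℂ] ℂ :=
  innerSL ℂ (ContinuousMap.toLp 2 AddCircle.haarAddCircle ℂ 1) ∘L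
    ContinuousMap.toLp 2 AddCircle.haarAddCircle ℂ

theorem integralCLM_apply (h : C(UnitAddCircle, ℂ)) :
    integralCLM h = ∫ x, h x ∂AddCircle.haarAddCircle := by
  refine (ContinuousMap.inner_toLp AddCircle.haarAddCircle 1 h).trans ?_
  simp

theorem coe_smul_ne_zero_of_irrational {β : ℝ} (hβ : Irrational β) {m : ℤ} (hm : m ≠ 0) :
    m • (β : UnitAddCircle) ≠ 0 := by
  intro h
  rw [← AddCircle.coe_zsmul, AddCircle.coe_eq_zero_iff] at h
  obtain ⟨k, hk⟩ := h
  refine (irrational_intCast_mul_iff.mpr ⟨hm, hβ⟩).ne_int k ?_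
  simpa using hk.symm

theorem fourier_ne_one_of_irrational {β : ℝ} (hβ : Irrational β) {m : ℤ} (hm : m ≠ 0) :
    fourier m (β : UnitAddCircle) ≠ 1 := by
  rw [fourier_apply, ← Circle.coe_one, Ne, Circle.coe_inj,
    ← AddCircle.toCircle_zero (T := 1)]
  exact fun h => coe_smul_ne_zero_of_irrational hβ hm
    (AddCircle.injective_toCircle one_ne_zero h)

theorem ergodic_add_of_irrational {β : ℝ} (hβ : Irrational β) :
    Ergodic (fun x : UnitAddCircle => x + (β : UnitAddCircle)) AddCircle.haarAddCircle := by
  have h : addOrderOf (β : UnitAddCircle) = 0 := by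
    rw [addOrderOf_eq_zero_iff']
    intro n hn h
    exact coe_smul_ne_zero_of_irrational hβ (m := n) (by exact_mod_cast hn.ne') (by simpa using h)
  have := AddCircle.ergodic_add_right.mpr h
  rwa [AddCircle.volume_eq_smul_haarAddCircle, ENNReal.ofReal_one, one_smul] at this

/-! ### Density of the monomials, and the trace on `h(U) Vⁿ`. -/

namespace NCTorus

variable (α : ℝ)

theorem calcU_fourier_mul_powV (m n : ℤ) : calcU α (fourier m) * powV α n =
    ((unitaryU α ^ m * unitaryV α ^ n : unitary (NCTorus α)) : NCTorus α) := by
  rw [calcU_fourier]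
  rfl

theorem powV_add (m n : ℤ) : powV α (m + n) = powV α m * powV α n := by
  rw [powV, zpow_add]
  rfl

theorem fourier_mul_fourier (m n : ℤ) :
    (fourier m * fourier n : C(UnitAddCircle, ℂ)) = fourier (m + n) := by
  ext x
  exact fourier_add.symm

theorem star_fourier (m : ℤ) : star (fourier m : C(UnitAddCircle, ℂ)) = fourier (-m) := by
  ext x
  exact fourier_neg.symm

theorem star_calcU_mul_powV (h : C(UnitAddCircle, ℂ)) (n : ℤ) :
    star (calcU α h * powV α n) =
      calcU α (translation (n • (α : UnitAddCircle)) (star h)) * powV α (-n) := by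
  rw [star_mul, ← map_star, star_powV, powV_mul_calcU, neg_smul, neg_neg]

/-- The linear span of the monomials `U^m V^n`. -/
def monomialSpan : Submodule ℂ (NCTorus α) :=
  Submodule.span ℂ (Set.range fun p : ℤ × ℤ => calcU α (fourier p.1) * powV α p.2)

theorem monomial_mem (m n : ℤ) : calcU α (fourier m) * powV α n ∈ monomialSpan α :=
  Submodule.subset_span ⟨(m, n), rfl⟩

theorem mul_mem_monomialSpan {x y : NCTorus α} (hx : x ∈ monomialSpan α)
    (hy : y ∈ monomialSpan α) : x * y ∈ monomialSpan α := by
  refine Submodule.mul_le.mpr ?_ (Submodule.mul_mem_mul hx hy)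
  clear hx hy x y
  intro x hx y hy
  have h := Submodule.mul_mem_mul hx hy
  rw [monomialSpan, Submodule.span_mul_span] at h
  refine Submodule.span_le.mpr ?_ h
  rintro _ ⟨_, ⟨⟨m, n⟩, rfl⟩, _, ⟨⟨k, l⟩, rfl⟩, rfl⟩
  change calcU α (fourier m) * powV α n * (calcU α (fourier k) * powV α l) ∈ monomialSpan α
  rw [mul_assoc, ← mul_assoc (powV α n), powV_mul_calcU, translation_fourier, map_smul,
    smul_mul_assoc, smul_mul_assoc, mul_smul_comm]
  refine Submodule.smul_mem _ _ ?_
  rw [mul_assoc, ← powV_add, ← mul_assoc, ← map_mul, fourier_mul_fourier]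
  exact monomial_mem α _ _

theorem star_mem_monomialSpan {x : NCTorus α} (hx : x ∈ monomialSpan α) :
    star x ∈ monomialSpan α := by
  induction hx using Submodule.span_induction with
  | mem x hx =>
    obtain ⟨⟨m, n⟩, rfl⟩ := hx
    change star (calcU α (fourier m) * powV α n) ∈ _
    rw [star_calcU_mul_powV, star_fourier, translation_fourier, map_smul, smul_mul_assoc]
    exact Submodule.smul_mem _ _ (monomial_mem α _ _)
  | zero => simp
  | add x y _ _ hx hy => rw [star_add]; exact add_mem hx hy
  | smul c x _ hx => rw [star_smul]; exact Submodule.smul_mem _ _ hx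

theorem adjoin_le_monomialSpan {x : NCTorus α} (hx : x ∈ StarAlgebra.adjoin ℂ {U α, V α}) :
    x ∈ monomialSpan α := by
  have hone : (1 : NCTorus α) ∈ monomialSpan α := by
    have h := monomial_mem α 0 0
    rw [calcU_fourier_mul_powV] at h
    simpa using h
  induction hx using StarAlgebra.adjoin_induction with
  | mem x hx =>
    rcases hx with rfl | rfl
    · have h := monomial_mem α 1 0
      rwa [calcU_fourier_one, powV_zero, mul_one] at h
    · have h := monomial_mem α 0 1
      rw [calcU_fourier_mul_powV, zpow_zero, one_mul, zpow_one] at h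
      exact h
  | algebraMap r =>
    rw [Algebra.algebraMap_eq_smul_one]
    exact Submodule.smul_mem _ _ hone
  | add x y _ _ hx hy => exact add_mem hx hy
  | mul x y _ _ hx hy => exact mul_mem_monomialSpan α hx hy
  | star x _ hx => exact star_mem_monomialSpan α hx

variable {α} in
/-- The image of `𝔸_α` under a representation is generated by the images of the generators. -/
theorem map_mem_closure_adjoin {B : Type*} [CStarAlgebra B] {u v : B} (h : IsTorusPair α u v)
    {φ : NCTorus α →⋆ₐ[ℂ] B} (hφu : φ (U α) = u) (hφv : φ (V α) = v) (x : NCTorus α) :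
    φ x ∈ closure (StarAlgebra.adjoin ℂ {u, v} : Set B) := by
  let S : StarSubalgebra ℂ B := (StarAlgebra.adjoin ℂ {u, v}).topologicalClosure
  have hS : IsClosed (S : Set B) := StarSubalgebra.isClosed_topologicalClosure _
  let _ : CStarAlgebra S := StarSubalgebra.cstarAlgebra S (h_closed := hS)
  have hu : u ∈ S :=
    StarSubalgebra.le_topologicalClosure _ (StarAlgebra.subset_adjoin ℂ _ (by simp))
  have hv : v ∈ S :=
    StarSubalgebra.le_topologicalClosure _ (StarAlgebra.subset_adjoin ℂ _ (by simp))
  have hp : IsTorusPair α (⟨u, hu⟩ : S) (⟨v, hv⟩ : S) :=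
    { u_mem := Unitary.mem_iff.mpr
        ⟨Subtype.ext (Unitary.mem_iff.mp h.u_mem).1, Subtype.ext (Unitary.mem_iff.mp h.u_mem).2⟩
      v_mem := Unitary.mem_iff.mpr
        ⟨Subtype.ext (Unitary.mem_iff.mp h.v_mem).1, Subtype.ext (Unitary.mem_iff.mp h.v_mem).2⟩
      comm := Subtype.ext h.comm }
  -- The pair already lives in the closed subalgebra `S`, so the universal property gives a map into
  -- `S`; uniqueness identifies it with `φ`, whose range therefore lies in `S`.
  have hid : S.subtype.comp (lift hp) = φ :=
    hom_ext ((congrArg Subtype.val (lift_U hp)).trans hφu.symm)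
      ((congrArg Subtype.val (lift_V hp)).trans hφv.symm)
  rw [← StarSubalgebra.topologicalClosure_coe, ← hid]
  exact (lift hp x).2

theorem dense_monomialSpan : Dense (monomialSpan α : Set (NCTorus α)) := by
  have h : Dense (StarAlgebra.adjoin ℂ {U α, V α} : Set (NCTorus α)) :=
    map_mem_closure_adjoin (pair_UV α) (φ := StarAlgHom.id ℂ (NCTorus α)) rfl rfl
  exact h.mono fun x hx => adjoin_le_monomialSpan α hx

/-- Continuous linear maps on `𝔸_α` are determined by their values on the monomials. -/
theorem clm_ext_monomial {E : Type*} [NormedAddCommGroup E] [NormedSpace ℂ E]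
    {F G : NCTorus α →L[ℂ] E}
    (h : ∀ m n : ℤ, F (calcU α (fourier m) * powV α n) = G (calcU α (fourier m) * powV α n)) :
    F = G := by
  refine ContinuousLinearMap.ext_on (dense_monomialSpan α) ?_
  rintro _ ⟨⟨m, n⟩, rfl⟩
  exact h m n

/-- The map `h ↦ h(U) V^n`. -/
def calcUV (n : ℤ) : C(UnitAddCircle, ℂ) →L[ℂ] NCTorus α :=
  (ContinuousLinearMap.mul ℂ (NCTorus α)).flip (powV α n) ∘L (calcU α).toCLM

theorem calcUV_apply (n : ℤ) (h : C(UnitAddCircle, ℂ)) :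
    calcUV α n h = calcU α h * powV α n := rfl

/-- Both sides are continuous and linear in `h`, so it is enough to compare them on characters,
where the trace of a monomial is known. -/
theorem trace_calcU_mul_powV (h : C(UnitAddCircle, ℂ)) (n : ℤ) :
    trace α (calcU α h * powV α n) =
      if n = 0 then ∫ x, h x ∂AddCircle.haarAddCircle else 0 := by
  have key : trace α ∘L calcUV α n = if n = 0 then integralCLM else 0 := by
    refine ContinuousMap.clm_ext_fourier fun m => ?_
    rw [ContinuousLinearMap.comp_apply, calcUV_apply, calcU_fourier_mul_powV, trace_monomial]
    split_ifs with h1 h2 h2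
    · rw [integralCLM_apply, integral_fourier, if_pos h1.1]
    · exact absurd h1.2 h2
    · rw [integralCLM_apply, integral_fourier, if_neg fun hm => h1 ⟨hm, h2⟩]
    · rfl
  have h1 := DFunLike.congr_fun key h
  rw [ContinuousLinearMap.comp_apply, calcUV_apply] at h1
  rw [h1]
  split_ifs
  · exact integralCLM_apply h
  · rfl

theorem trace_star_mul_self (y : NCTorus α) :
    trace α (star y * y) = ((‖regRep α y vac‖ ^ 2 : ℝ) : ℂ) := by
  change ⟪vac, regRep α (star y * y) vac⟫_ℂ = _
  rw [map_mul, map_star, ContinuousLinearMap.star_eq_adjoint, mul_apply_eq_comp,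
    ContinuousLinearMap.adjoint_inner_right, inner_self_eq_norm_sq_to_K]
  simp

theorem isState_trace : IsState (trace α) := by
  constructor
  · have h := trace_monomial α 0 0
    simpa using h
  · intro a
    rw [trace_star_mul_self]
    exact Complex.zero_le_real.mpr (sq_nonneg _)

theorem trace_anzai (θ : ℝ) (f : C(Circle, Circle)) (a : NCTorus α) :
    trace α (anzai α θ f a) = trace α a := by
  let Φ : NCTorus α →⋆ₐ[ℂ] NCTorus α := (anzai α θ f : NCTorus α ≃⋆ₐ[ℂ] NCTorus α)
  suffices h : trace α ∘L Φ.toCLM = trace α from DFunLike.congr_fun h a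
  refine clm_ext_monomial α fun m n => ?_
  change trace α (anzai α θ f (calcU α (fourier m) * powV α n)) = _
  rw [anzai_calcU_mul_powV, trace_calcU_mul_powV, trace_calcU_mul_powV]
  split_ifs with hn
  · subst hn
    rw [cocycleFun_zero, mul_one]
    exact integral_add_right_eq_self (fun x => fourier m x) _
  · rfl

theorem trace_mem_invariantStates (θ : ℝ) (f : C(Circle, Circle)) :
    trace α ∈ invariantStates (anzai α θ f) :=
  ⟨isState_trace α, trace_anzai α θ f⟩

/-- Conjugation by `Vⁿ` only translates `|h|²`, which Haar measure does not see. This turns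
domination by the trace into an `L²` bound on each row. -/
theorem trace_star_calcUV (n : ℤ) (h : C(UnitAddCircle, ℂ)) :
    trace α (star (calcUV α n h) * calcUV α n h) =
      ((‖ContinuousMap.toLp (E := ℂ) 2 AddCircle.haarAddCircle ℂ h‖ ^ 2 : ℝ) : ℂ) := by
  have h1 : star (calcUV α n h) * calcUV α n h =
      calcU α (translation (n • (α : UnitAddCircle)) (star h * h)) * powV α 0 := by
    rw [calcUV_apply, star_mul, ← map_star, star_powV, mul_assoc, ← mul_assoc (calcU α _),
      ← map_mul, ← mul_assoc, powV_mul_calcU, mul_assoc, ← powV_add, neg_add_cancel,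
      neg_smul, neg_neg]
  rw [h1, trace_calcU_mul_powV, if_pos rfl]
  have h2 : ((‖ContinuousMap.toLp (E := ℂ) 2 AddCircle.haarAddCircle ℂ h‖ ^ 2 : ℝ) : ℂ) =
      ⟪ContinuousMap.toLp (E := ℂ) 2 AddCircle.haarAddCircle ℂ h,
        ContinuousMap.toLp (E := ℂ) 2 AddCircle.haarAddCircle ℂ h⟫_ℂ := by
    rw [inner_self_eq_norm_sq_to_K]
    simp
  rw [h2, ContinuousMap.inner_toLp]
  refine (integral_add_right_eq_self (fun x => (star h * h) x) _).trans ?_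
  refine integral_congr_ae (Filter.Eventually.of_forall fun x => ?_)
  exact mul_comm _ _

end NCTorus

/-! ### Hermitian symmetry and Cauchy–Schwarz for states. -/

section States

variable {A : Type*} [CStarAlgebra A] {φ : A →L[ℂ] ℂ}

theorem IsState.map_star (hφ : IsState φ) (y : A) : φ (star y) = conj (φ y) := by
  have key : ∀ z : ℂ, (φ (star (z • 1 + y) * (z • 1 + y))).im = 0 := fun z =>
    (Complex.nonneg_iff.mp (hφ.2 _)).2.symm
  have h0 := (Complex.nonneg_iff.mp (hφ.2 y)).2
  have expand : ∀ z : ℂ, φ (star (z • 1 + y) * (z • 1 + y)) =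
      conj z * z + conj z * φ y + z * φ (star y) + φ (star y * y) := fun z => by
    simp only [star_add, star_smul, star_one, add_mul, mul_add, smul_mul_assoc, mul_smul_comm,
      one_mul, mul_one, map_add, map_smul, hφ.1, smul_eq_mul, Complex.star_def]
    ring
  -- The value `z = 1` shows that the imaginary parts of `φ y` and `φ (star y)` are opposite; `z =
  -- i` shows that their real parts agree.
  have h1 := key 1
  have h2 := key Complex.I
  rw [expand] at h1 h2
  simp at h1 h2
  apply Complex.ext
  · simp
    linarith
  · simp
    linarith

/-- The Cauchy–Schwarz inequality for states. -/
theorem IsState.norm_sq_le (hφ : IsState φ) (y : A) : ‖φ y‖ ^ 2 ≤ (φ (star y * y)).re := by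
  -- Positivity is applied to the centred element `y - φ(y)`, so the inequality is the nonnegativity
  -- of a variance.
  have h := (Complex.nonneg_iff.mp (hφ.2 (-(φ y) • 1 + y))).1
  have expand : φ (star (-(φ y) • 1 + y) * (-(φ y) • 1 + y)) =
      φ (star y * y) - φ y * conj (φ y) := by
    simp only [star_add, star_smul, star_one, add_mul, mul_add, smul_mul_assoc, mul_smul_comm,
      one_mul, mul_one, map_add, map_smul, hφ.1, smul_eq_mul, Complex.star_def, hφ.map_star,
      map_neg]
    ring
  rw [expand, Complex.mul_conj, Complex.sub_re, Complex.ofReal_re, Complex.normSq_eq_norm_sq] at h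
  linarith

end States

/-! ### Weak and pointwise forms of the cohomological equation. -/

theorem inner_continuousMap_toLp (g : Lp ℂ 2 (@AddCircle.haarAddCircle 1 _))
    (k : C(UnitAddCircle, ℂ)) :
    ⟪g, ContinuousMap.toLp (E := ℂ) 2 AddCircle.haarAddCircle ℂ k⟫_ℂ =
      ∫ x, k x * conj (g x) ∂AddCircle.haarAddCircle := by
  rw [L2.inner_def]
  refine integral_congr_ae ?_
  filter_upwards [ContinuousMap.coeFn_toLp (E := ℂ) (p := 2) (𝕜 := ℂ)
    (@AddCircle.haarAddCircle 1 _) k] with x hx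
  rw [hx]
  rfl

theorem measurePreserving_add_right_haar (b : UnitAddCircle) :
    MeasurePreserving (fun x : UnitAddCircle => x + b) AddCircle.haarAddCircle
      AddCircle.haarAddCircle :=
  measurePreserving_add_right _ b

section Twisted

variable {b : UnitAddCircle} {F : C(UnitAddCircle, ℂ)}
  {g : Lp ℂ 2 (@AddCircle.haarAddCircle 1 _)}

/-- After substituting the equation for `conj g`, the two factors of `F` cancel by unimodularity and
what remains is a translate of the other integrand. -/
theorem inner_twisted_of_solution (hF : ∀ x, conj (F x) * F x = 1)
    (hg : ∀ᵐ x ∂AddCircle.haarAddCircle, g (x + b) * F x = g x) (h : C(UnitAddCircle, ℂ)) :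
    ⟪g, ContinuousMap.toLp (E := ℂ) 2 AddCircle.haarAddCircle ℂ (translation b h * F)⟫_ℂ =
      ⟪g, ContinuousMap.toLp (E := ℂ) 2 AddCircle.haarAddCircle ℂ h⟫_ℂ := by
  rw [inner_continuousMap_toLp, inner_continuousMap_toLp,
    ← integral_add_right_eq_self (fun x => h x * conj (g x)) b]
  refine integral_congr_ae ?_
  filter_upwards [hg] with x hx
  rw [← hx, map_mul]
  change h (x + b) * F x * _ = _
  linear_combination h (x + b) * conj (g (x + b)) * hF x

/-- Continuous functions are dense in `L²`, so it suffices that `x ↦ g (x + b) * F x` and `g` have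
the same inner product with each continuous `k`. -/
theorem solution_of_inner_twisted (hF : ∀ x, conj (F x) * F x = 1)
    (hg : ∀ h : C(UnitAddCircle, ℂ),
      ⟪g, ContinuousMap.toLp (E := ℂ) 2 AddCircle.haarAddCircle ℂ (translation b h * F)⟫_ℂ =
        ⟪g, ContinuousMap.toLp (E := ℂ) 2 AddCircle.haarAddCircle ℂ h⟫_ℂ) :
    ∀ᵐ x ∂AddCircle.haarAddCircle, g (x + b) * F x = g x := by
  have hnorm : ∀ x, ‖F x‖ = 1 := fun x => by
    have := congrArg norm (hF x)
    rw [norm_mul, RCLike.norm_conj, norm_one] at this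
    nlinarith [norm_nonneg (F x)]
  have hgb := (Lp.memLp g).comp_measurePreserving (measurePreserving_add_right_haar b)
  have hmem : MemLp (fun x => g (x + b) * F x) 2 AddCircle.haarAddCircle := by
    refine hgb.of_le (hgb.1.mul F.continuous.aestronglyMeasurable) ?_
    exact Filter.Eventually.of_forall fun x => by
      rw [norm_mul, hnorm, mul_one]
      rfl
  have heq : hmem.toLp = g := by
    refine (ContinuousMap.toLp_denseRange ℂ AddCircle.haarAddCircle ℂ
      (p := 2) (by norm_num)).eq_of_inner_left ℂ ?_
    intro k
    -- The test function is chosen so that twisting it by translation and `F` returns exactly `k`.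
    have h1 : translation b (translation (-b) (k * star F)) = k * star F := by
      ext x
      simp
    have h2 := hg (translation (-b) (k * star F))
    have h3 : k * star F * F = k := by
      ext x
      change k x * conj (F x) * F x = k x
      rw [mul_assoc, hF, mul_one]
    rw [h1, h3] at h2
    rw [h2, inner_continuousMap_toLp, inner_continuousMap_toLp,
      ← integral_add_right_eq_self (fun x => _ * conj (g x)) b]
    refine integral_congr_ae ?_
    filter_upwards [hmem.coeFn_toLp] with x hx
    have h4 : translation (-b) (k * star F) (x + b) = k x * conj (F x) := by
      have := DFunLike.congr_fun h1 x
      exact this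
    rw [hx, h4, map_mul]
    ring
  filter_upwards [hmem.coeFn_toLp] with x hx
  rw [heq] at hx
  exact hx.symm

end Twisted

/-! ### No solutions implies ergodicity. -/

namespace NCTorus

variable {α θ : ℝ} {f : C(Circle, Circle)}

/-- Cauchy–Schwarz and domination bound `|φ(h(U) Vⁿ)|` by `C` times the `L²` norm of `h`. The
functional therefore extends to `L²` by density, and the Riesz theorem supplies `g`. -/
theorem exists_inner_eq_of_dominated {φ : NCTorus α →L[ℂ] ℂ} (hφ : IsState φ) {C : ℝ}
    (hC : ∀ y, (φ (star y * y)).re ≤ C ^ 2 * (trace α (star y * y)).re) (hC0 : 0 ≤ C) (n : ℤ) :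
    ∃ g : Lp ℂ 2 (@AddCircle.haarAddCircle 1 _), ∀ h : C(UnitAddCircle, ℂ),
      ⟪g, ContinuousMap.toLp (E := ℂ) 2 AddCircle.haarAddCircle ℂ h⟫_ℂ =
        φ (calcUV α n h) := by
  let e : C(UnitAddCircle, ℂ) →ₗ[ℂ] Lp ℂ 2 (@AddCircle.haarAddCircle 1 _) :=
    (ContinuousMap.toLp (E := ℂ) 2 AddCircle.haarAddCircle ℂ).toLinearMap
  let L : C(UnitAddCircle, ℂ) →ₗ[ℂ] ℂ := (φ ∘L calcUV α n).toLinearMap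
  have hbound : ∃ C : ℝ, ∀ h, ‖L h‖ ≤ C * ‖e h‖ := by
    refine ⟨C, fun h => ?_⟩
    refine (pow_le_pow_iff_left₀ (norm_nonneg _) (by positivity) two_ne_zero).mp ?_
    refine (hφ.norm_sq_le (calcUV α n h)).trans ((hC _).trans_eq ?_)
    rw [trace_star_calcUV, Complex.ofReal_re, mul_pow]
    rfl
  have hdense : DenseRange e :=
    ContinuousMap.toLp_denseRange ℂ AddCircle.haarAddCircle ℂ (p := 2) (by norm_num)
  refine ⟨(InnerProductSpace.toDual ℂ _).symm (L.extendOfNorm e), fun h => ?_⟩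
  rw [InnerProductSpace.toDual_symm_apply]
  exact LinearMap.extendOfNorm_eq hdense hbound h

/-- On row `0`, irrationality makes the eigenvalue of each nontrivial character different from `1`,
killing its value under an invariant functional. On any other row the Riesz vector solves the
cohomological equation weakly, hence almost everywhere, and so is zero. -/
theorem eq_trace_of_dominated (hθ : Irrational (θ / (2 * Real.pi)))
    (hsol : ∀ n : ℤ, n ≠ 0 → ∀ g : Lp ℂ 2 (@AddCircle.haarAddCircle 1 _),
      (∀ᵐ x ∂AddCircle.haarAddCircle,
        g (x + ((θ / (2 * Real.pi) : ℝ) : UnitAddCircle)) * cocycleFun α f n x = g x) → g = 0)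
    {φ : NCTorus α →L[ℂ] ℂ} (hφ : φ ∈ invariantStates (anzai α θ f)) {C : ℝ}
    (hC : ∀ y, (φ (star y * y)).re ≤ C ^ 2 * (trace α (star y * y)).re) (hC0 : 0 ≤ C) :
    φ = trace α := by
  refine clm_ext_monomial α fun m n => ?_
  have hinv := fun h : C(UnitAddCircle, ℂ) => hφ.2 (calcUV α n h)
  simp only [calcUV_apply, anzai_calcU_mul_powV] at hinv
  rw [trace_calcU_mul_powV, integral_fourier]
  rcases eq_or_ne n 0 with rfl | hn
  · rw [if_pos rfl]
    split_ifs with hm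
    · subst hm
      rw [calcU_fourier_mul_powV]
      simpa using hφ.1.1
    · have h1 := hinv (fourier m)
      rw [cocycleFun_zero, mul_one, translation_fourier, map_smul, smul_mul_assoc, map_smul,
        smul_eq_mul] at h1
      by_contra h0
      exact fourier_ne_one_of_irrational hθ hm (mul_eq_right₀ h0 |>.mp h1)
  · rw [if_neg hn]
    obtain ⟨g, hg⟩ := exists_inner_eq_of_dominated hφ.1 hC hC0 n
    have hg0 : g = 0 := by
      refine hsol n hn g (solution_of_inner_twisted (conj_cocycleFun_mul_self α f n) fun h => ?_)
      rw [hg, hg]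
      exact hinv h
    have h1 := hg (fourier m)
    rw [hg0, inner_zero_left] at h1
    exact h1.symm

theorem isErgodicSystem_of_no_solution (hθ : Irrational (θ / (2 * Real.pi)))
    (hsol : ∀ n : ℤ, n ≠ 0 → ∀ g : Lp ℂ 2 (@AddCircle.haarAddCircle 1 _),
      (∀ᵐ x ∂AddCircle.haarAddCircle,
        g (x + ((θ / (2 * Real.pi) : ℝ) : UnitAddCircle)) * cocycleFun α f n x = g x) → g = 0) :
    IsErgodicSystem (anzai α θ f) (trace α) := by
  refine ⟨trace_mem_invariantStates α θ f, fun φ hφ ψ hψ hseg => ?_⟩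
  obtain ⟨a, b, ha, hb, -, hab⟩ := hseg
  -- Dropping the nonnegative `ψ` term from `aφ + bψ = τ` leaves `φ ≤ a⁻¹ τ` on positive elements,
  -- so `C ^ 2 = a⁻¹`.
  refine eq_trace_of_dominated hθ hsol hφ (C := (Real.sqrt a)⁻¹) (fun y => ?_) (by positivity)
  have h1 := congrArg Complex.re (DFunLike.congr_fun hab (star y * y))
  simp only [add_apply, smul_apply, Complex.add_re,
    Complex.smul_re, smul_eq_mul] at h1
  have h2 : 0 ≤ (ψ (star y * y)).re := (Complex.nonneg_iff.mp (hψ.1.2 y)).1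
  rw [inv_pow, Real.sq_sqrt ha.le, ← h1, inv_mul_eq_div, le_div_iff₀ ha]
  nlinarith [mul_nonneg hb.le h2]

end NCTorus

/-! ### A solution destroys extremality: vector states on `ℓ²(ℤ × ℤ)`. -/

namespace NCTorus

theorem memℓp_row (n : ℤ) (ζ : lp (fun _ : ℤ => ℂ) 2) :
    Memℓp (fun p : ℤ × ℤ => if p.2 = n then ζ p.1 else 0) 2 := by
  have h := lp.memℓp ζ
  rw [memℓp_gen_iff (by norm_num)] at h ⊢
  have hinj : Function.Injective fun m : ℤ => (m, n) := fun a b hab => congrArg Prod.fst hab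
  refine (hinj.summable_iff ?_).mp (by simpa [Function.comp_def] using h)
  rintro ⟨k, l⟩ hp
  have : l ≠ n := fun hl => hp ⟨k, by rw [hl]⟩
  simp [this]

/-- The vector of `ℓ²(ℤ × ℤ)` supported on the `n`-th row with entries the Fourier coefficients
of `g`. -/
def rowVector (n : ℤ) (g : Lp ℂ 2 (@AddCircle.haarAddCircle 1 _)) : L2Z :=
  ⟨fun p => if p.2 = n then fourierBasis.repr g p.1 else 0, memℓp_row n (fourierBasis.repr g)⟩

theorem rowVector_apply (n : ℤ) (g : Lp ℂ 2 (@AddCircle.haarAddCircle 1 _)) (p : ℤ × ℤ) :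
    rowVector n g p = if p.2 = n then fourierBasis.repr g p.1 else 0 := rfl

/-- Parseval's identity: the only nonzero entries of the sum over `ℤ × ℤ` lie on row `n`. -/
theorem inner_rowVector (n : ℤ) (g g' : Lp ℂ 2 (@AddCircle.haarAddCircle 1 _)) :
    ⟪rowVector n g, rowVector n g'⟫_ℂ = ⟪g, g'⟫_ℂ := by
  have hinj : Function.Injective fun m : ℤ => (m, n) := fun a b hab => congrArg Prod.fst hab
  rw [lp.inner_eq_tsum, ← fourierBasis.repr.inner_map_map g g', lp.inner_eq_tsum,
    ← hinj.tsum_eq]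
  · simp [rowVector_apply]
  · rintro ⟨k, l⟩ hp
    by_contra h
    have hl : l ≠ n := fun hl => h ⟨k, by rw [hl]⟩
    exact hp (by simp [rowVector_apply, hl])

variable (α : ℝ)

/-- The matrix coefficient `x ↦ ⟨ξ, x η⟩` of the regular representation. -/
def coefficient (ξ η : L2Z) : NCTorus α →L[ℂ] ℂ where
  toFun x := ⟪ξ, regRep α x η⟫_ℂ
  map_add' x y := by simp
  map_smul' c x := by simp
  cont := by
    have := continuous_starAlgHom (regRep α)
    fun_prop

theorem coefficient_apply (ξ η : L2Z) (x : NCTorus α) :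
    coefficient α ξ η x = ⟪ξ, regRep α x η⟫_ℂ := rfl

theorem coefficient_vac : coefficient α vac vac = trace α := rfl

theorem coefficient_star (ξ η : L2Z) (x : NCTorus α) :
    coefficient α ξ η (star x) = conj (coefficient α η ξ x) := by
  rw [coefficient_apply, coefficient_apply, map_star, ContinuousLinearMap.star_eq_adjoint,
    ContinuousLinearMap.adjoint_inner_right, inner_conj_symm]

theorem coefficient_star_mul_self (ξ : L2Z) (y : NCTorus α) :
    coefficient α ξ ξ (star y * y) = ((‖regRep α y ξ‖ ^ 2 : ℝ) : ℂ) := by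
  rw [coefficient_apply, map_mul, map_star, ContinuousLinearMap.star_eq_adjoint,
    mul_apply_eq_comp, ContinuousLinearMap.adjoint_inner_right, inner_self_eq_norm_sq_to_K]
  simp

theorem regRep_monomial_apply (m l : ℤ) (ξ : L2Z) (p : ℤ × ℤ) :
    regRep α (calcU α (fourier m) * powV α l) ξ p =
      (Circle.exp (-(2 * Real.pi * α * (p.1 - m : ℤ))) ^ l : Circle) * ξ (p.1 - m, p.2 - l) := by
  rw [calcU_fourier_mul_powV, regRep_monomial, regU_zpow, regV_zpow]

theorem regRep_monomial_vac (m l : ℤ) :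
    regRep α (calcU α (fourier m) * powV α l) vac = lp.single 2 (m, l) (1 : ℂ) := by
  ext ⟨k, j⟩
  rw [regRep_monomial_apply, vac, lp.single_apply, lp.single_apply]
  by_cases h : k = m ∧ j = l
  · obtain ⟨rfl, rfl⟩ := h
    simp
  · rw [Pi.single_eq_of_ne, Pi.single_eq_of_ne, mul_zero]
    · exact fun h' => h ⟨congrArg Prod.fst h', congrArg Prod.snd h'⟩
    · refine fun h' => h ⟨sub_eq_zero.mp (congrArg Prod.fst h'), sub_eq_zero.mp (congrArg Prod.snd h')⟩

/-- Applied to the vacuum, `Uᵐ Vˡ` gives `δ_{m,l}`, so row `n` sees only `l = n` and reads off a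
Fourier coefficient of `g`. Continuity in `h` extends this from characters. -/
theorem coefficient_rowVector_vac (n l : ℤ) (g : Lp ℂ 2 (@AddCircle.haarAddCircle 1 _))
    (h : C(UnitAddCircle, ℂ)) :
    coefficient α (rowVector n g) vac (calcU α h * powV α l) =
      if l = n then ⟪g, ContinuousMap.toLp (E := ℂ) 2 AddCircle.haarAddCircle ℂ h⟫_ℂ else 0 := by
  have key : coefficient α (rowVector n g) vac ∘L calcUV α l =
      if l = n then innerSL ℂ g ∘L ContinuousMap.toLp (E := ℂ) 2 AddCircle.haarAddCircle ℂ
      else 0 := by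
    refine ContinuousMap.clm_ext_fourier fun m => ?_
    rw [ContinuousLinearMap.comp_apply, calcUV_apply, coefficient_apply, regRep_monomial_vac,
      lp.inner_single_right, rowVector_apply]
    split_ifs
    · change ⟪fourierBasis.repr g m, 1⟫_ℂ = ⟪g, fourierLp 2 m⟫_ℂ
      rw [fourierBasis.repr_apply_apply, coe_fourierBasis, ← inner_conj_symm g]
      simp
    · simp
  have h1 := DFunLike.congr_fun key h
  rw [ContinuousLinearMap.comp_apply, calcUV_apply] at h1
  rw [h1]
  split_ifs <;> rfl

/-- `Vⁿ` moves row `n` to row `2n`, away from the vacuum. At degree `n` only the opposite cross term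
can therefore survive. -/
theorem coefficient_vac_rowVector {n : ℤ} (hn : n ≠ 0)
    (g : Lp ℂ 2 (@AddCircle.haarAddCircle 1 _)) (m : ℤ) :
    coefficient α vac (rowVector n g) (calcU α (fourier m) * powV α n) = 0 := by
  rw [coefficient_apply, vac, lp.inner_single_left, regRep_monomial_apply, rowVector_apply,
    if_neg (by change ¬ (0 - n = n); omega)]
  simp

/-- For `l ≠ 0` the monomial moves row `n` to a disjoint row. For `l = 0` it multiplies `g` by a
character, and since `|g|² = 1` the inner product is the integral of that character. -/
theorem coefficient_rowVector_self (n : ℤ) {g : Lp ℂ 2 (@AddCircle.haarAddCircle 1 _)}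
    (hg : ∀ᵐ x ∂AddCircle.haarAddCircle, ‖g x‖ = 1) :
    coefficient α (rowVector n g) (rowVector n g) = trace α := by
  refine clm_ext_monomial α fun m l => ?_
  rw [trace_calcU_mul_powV, coefficient_apply]
  split_ifs with hl
  · subst hl
    have hmem : MemLp (fun x => fourier m x * g x) 2 (@AddCircle.haarAddCircle 1 _) := by
      refine (Lp.memLp g).of_le ((fourier m).continuous.aestronglyMeasurable.mul
        (Lp.aestronglyMeasurable g)) (Filter.Eventually.of_forall fun x => ?_)
      rw [norm_mul, fourier_apply, Circle.norm_coe, one_mul]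
    have h1 : regRep α (calcU α (fourier m) * powV α 0) (rowVector n g) =
        rowVector n hmem.toLp := by
      ext ⟨k, j⟩
      rw [regRep_monomial_apply, zpow_zero, Circle.coe_one, one_mul, rowVector_apply,
        rowVector_apply, sub_zero]
      congr 1
      rw [fourierBasis_repr, fourierBasis_repr, fourierCoeff_congr_ae hmem.coeFn_toLp]
      refine integral_congr_ae (Filter.Eventually.of_forall fun x => ?_)
      change fourier (-(k - m)) x * g x = fourier (-k) x * (fourier m x * g x)
      rw [← mul_assoc, ← fourier_add, neg_sub, sub_eq_neg_add]
    rw [h1, inner_rowVector, L2.inner_def]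
    refine integral_congr_ae ?_
    filter_upwards [hg, hmem.coeFn_toLp] with x hx hx'
    rw [hx']
    change fourier m x * g x * conj (g x) = _
    rw [mul_assoc, Complex.mul_conj, Complex.normSq_eq_norm_sq, hx]
    simp
  · rw [lp.inner_eq_tsum]
    refine (tsum_congr fun p => ?_).trans tsum_zero
    rw [regRep_monomial_apply, rowVector_apply, rowVector_apply]
    split_ifs with h1 h2 h2
    · change p.2 - l = n at h2
      omega
    all_goals simp

variable {α} {θ : ℝ} {f : C(Circle, Circle)}

theorem coefficient_rowVector_anzai {n : ℤ} {g : Lp ℂ 2 (@AddCircle.haarAddCircle 1 _)}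
    (hg : ∀ᵐ x ∂AddCircle.haarAddCircle,
      g (x + ((θ / (2 * Real.pi) : ℝ) : UnitAddCircle)) * cocycleFun α f n x = g x)
    (a : NCTorus α) :
    coefficient α (rowVector n g) vac (anzai α θ f a) = coefficient α (rowVector n g) vac a := by
  let Φ : NCTorus α →⋆ₐ[ℂ] NCTorus α := (anzai α θ f : NCTorus α ≃⋆ₐ[ℂ] NCTorus α)
  suffices h : coefficient α (rowVector n g) vac ∘L Φ.toCLM = coefficient α (rowVector n g) vac
    from DFunLike.congr_fun h a
  refine clm_ext_monomial α fun m l => ?_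
  change coefficient α _ _ (anzai α θ f (calcU α (fourier m) * powV α l)) = _
  rw [anzai_calcU_mul_powV, coefficient_rowVector_vac, coefficient_rowVector_vac]
  split_ifs with hl
  · subst hl
    exact inner_twisted_of_solution (conj_cocycleFun_mul_self α f l) hg _
  · rfl

/-- Taking adjoints exchanges the two cross terms, and the automorphism commutes with the
involution. -/
theorem coefficient_vac_anzai {n : ℤ} {g : Lp ℂ 2 (@AddCircle.haarAddCircle 1 _)}
    (hg : ∀ᵐ x ∂AddCircle.haarAddCircle,
      g (x + ((θ / (2 * Real.pi) : ℝ) : UnitAddCircle)) * cocycleFun α f n x = g x)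
    (a : NCTorus α) :
    coefficient α vac (rowVector n g) (anzai α θ f a) = coefficient α vac (rowVector n g) a := by
  rw [← star_star a, map_star, coefficient_star, coefficient_star, coefficient_rowVector_anzai hg]

theorem coefficient_combination (c : ℝ) (ξ : L2Z) (a : NCTorus α) :
    coefficient α (vac + (c : ℂ) • ξ) (vac + (c : ℂ) • ξ) a =
      trace α a + c * (coefficient α vac ξ a + coefficient α ξ vac a) +
        c ^ 2 * coefficient α ξ ξ a := by
  rw [← coefficient_vac]
  simp only [coefficient_apply, map_add, map_smul, inner_add_left, inner_add_right,
    inner_smul_left, inner_smul_right, Complex.conj_ofReal]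
  ring

/-- The state implemented by the perturbation of the vacuum along a solution of the
cohomological equation. -/
def perturbedState (α : ℝ) (c : ℝ) (ξ : L2Z) : NCTorus α →L[ℂ] ℂ :=
  (1 / 2 : ℝ) • coefficient α (vac + (c : ℂ) • ξ) (vac + (c : ℂ) • ξ)

/-- The two diagonal terms contribute `τ/2` each, leaving the trace plus a term odd in `c`;
averaging over `c = ±1` thus returns the trace. -/
theorem perturbedState_apply {c : ℝ} (hc : c ^ 2 = 1) {ξ : L2Z}
    (hξ : coefficient α ξ ξ = trace α) (a : NCTorus α) :
    perturbedState α c ξ a =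
      trace α a + c / 2 * (coefficient α vac ξ a + coefficient α ξ vac a) := by
  have hc' : (c : ℂ) ^ 2 = 1 := by exact_mod_cast hc
  change (1 / 2 : ℝ) • coefficient α (vac + (c : ℂ) • ξ) (vac + (c : ℂ) • ξ) a = _
  rw [coefficient_combination, hξ, hc', Complex.real_smul]
  push_cast
  ring

/-- The factor `1/2` is the right normalisation because, for `n ≠ 0`, the cross terms vanish at `1`.
Invariance holds separately for the trace and for each cross term. -/
theorem perturbedState_mem {n : ℤ} (hn : n ≠ 0) {g : Lp ℂ 2 (@AddCircle.haarAddCircle 1 _)}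
    (hg1 : ∀ᵐ x ∂AddCircle.haarAddCircle, ‖g x‖ = 1)
    (hg : ∀ᵐ x ∂AddCircle.haarAddCircle,
      g (x + ((θ / (2 * Real.pi) : ℝ) : UnitAddCircle)) * cocycleFun α f n x = g x)
    {c : ℝ} (hc : c ^ 2 = 1) :
    perturbedState α c (rowVector n g) ∈ invariantStates (anzai α θ f) := by
  have hξ := coefficient_rowVector_self α n hg1
  refine ⟨⟨?_, fun a => ?_⟩, fun a => ?_⟩
  · have h1 : coefficient α (rowVector n g) vac 1 = 0 := by
      have := coefficient_rowVector_vac α n 0 g 1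
      rwa [map_one, powV_zero, mul_one, if_neg hn.symm] at this
    have h2 : coefficient α vac (rowVector n g) 1 = 0 := by
      have := coefficient_star α vac (rowVector n g) 1
      rwa [star_one, h1, map_zero] at this
    rw [perturbedState_apply hc hξ, h1, h2, (isState_trace α).1]
    simp
  · change 0 ≤ (1 / 2 : ℝ) • coefficient α _ _ (star a * a)
    rw [coefficient_star_mul_self, Complex.real_smul, ← Complex.ofReal_mul]
    exact Complex.zero_le_real.mpr (by positivity)
  · rw [perturbedState_apply hc hξ, perturbedState_apply hc hξ, trace_anzai,
      coefficient_vac_anzai hg, coefficient_rowVector_anzai hg]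

/-- Extremality would make the cross term vanish. Tested on `Uᵐ Vⁿ`, this says that every Fourier
coefficient of `g` is zero, which is incompatible with `|g| = 1`. -/
theorem not_isErgodicSystem_of_unimodular_solution {n : ℤ} (hn : n ≠ 0)
    {g : Lp ℂ 2 (@AddCircle.haarAddCircle 1 _)}
    (hg1 : ∀ᵐ x ∂AddCircle.haarAddCircle, ‖g x‖ = 1)
    (hg : ∀ᵐ x ∂AddCircle.haarAddCircle,
      g (x + ((θ / (2 * Real.pi) : ℝ) : UnitAddCircle)) * cocycleFun α f n x = g x) :
    ¬ IsErgodicSystem (anzai α θ f) (trace α) := by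
  intro h
  have hξ := coefficient_rowVector_self α n hg1
  have heq : perturbedState α 1 (rowVector n g) = trace α := by
    refine h.2 (perturbedState_mem hn hg1 hg (c := 1) (by norm_num))
      (perturbedState_mem hn hg1 hg (c := -1) (by norm_num)) ?_
    refine ⟨1 / 2, 1 / 2, by norm_num, by norm_num, by norm_num, ?_⟩
    ext a
    change (1 / 2 : ℝ) • perturbedState α 1 _ a + (1 / 2 : ℝ) • perturbedState α (-1) _ a = _
    rw [perturbedState_apply (by norm_num) hξ, perturbedState_apply (by norm_num) hξ,
      Complex.real_smul, Complex.real_smul]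
    push_cast
    ring
  have hzero : g = 0 := by
    rw [← fourierBasis.repr.map_eq_zero_iff]
    ext m
    have h1 := DFunLike.congr_fun heq (calcU α (fourier m) * powV α n)
    rw [perturbedState_apply (by norm_num) hξ, coefficient_vac_rowVector α hn,
      coefficient_rowVector_vac, if_pos rfl] at h1
    have h2 : ⟪g, fourierLp 2 m⟫_ℂ = 0 := by
      have : ((1 : ℝ) : ℂ) / 2 * (0 + ⟪g, fourierLp 2 m⟫_ℂ) = 0 := add_eq_left.mp h1
      simpa using this
    rw [fourierBasis.repr_apply_apply, coe_fourierBasis, ← inner_conj_symm, h2, map_zero]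
    rfl
  have hae : ∀ᵐ x ∂(@AddCircle.haarAddCircle 1 _), False := by
    filter_upwards [hg1, (Lp.eq_zero_iff_ae_eq_zero).mp hzero] with x hx hx'
    rw [hx'] at hx
    simp at hx
  exact hae.exists.choose_spec

/-- The cocycle has modulus one, so `|g|` is invariant under an ergodic rotation and hence constant.
A nonzero constant can be scaled to `1`, reducing to the unimodular case. -/
theorem eq_zero_of_isErgodicSystem (hθ : Irrational (θ / (2 * Real.pi)))
    (h : IsErgodicSystem (anzai α θ f) (trace α)) {n : ℤ} (hn : n ≠ 0)
    {g : Lp ℂ 2 (@AddCircle.haarAddCircle 1 _)}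
    (hg : ∀ᵐ x ∂AddCircle.haarAddCircle,
      g (x + ((θ / (2 * Real.pi) : ℝ) : UnitAddCircle)) * cocycleFun α f n x = g x) : g = 0 := by
  obtain ⟨c, hc⟩ := (ergodic_add_of_irrational hθ).ae_eq_const_of_ae_eq_comp_ae
    (g := fun x => ‖g x‖) (Lp.aestronglyMeasurable g).norm (by
      filter_upwards [hg] with x hx
      rw [← hx, norm_mul, cocycleFun_apply, norm_cocycle, mul_one]
      rfl)
  by_contra hg0
  have hc0 : c ≠ 0 := by
    rintro rfl
    refine hg0 ((Lp.eq_zero_iff_ae_eq_zero).mpr ?_)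
    filter_upwards [hc] with x hx
    exact norm_eq_zero.mp hx
  have hcpos : 0 < c := by
    obtain ⟨x, hx⟩ := hc.exists
    have hx' : ‖g x‖ = c := hx
    exact lt_of_le_of_ne (hx' ▸ norm_nonneg (g x)) hc0.symm
  have hsmul := Lp.coeFn_smul ((c⁻¹ : ℝ) : ℂ) g
  refine not_isErgodicSystem_of_unimodular_solution (g := ((c⁻¹ : ℝ) : ℂ) • g) hn ?_ ?_ h
  · filter_upwards [hsmul, hc] with x hx hx'
    rw [hx, Pi.smul_apply, norm_smul, Complex.norm_real, Real.norm_of_nonneg (by positivity),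
      show ‖g x‖ = c from hx', inv_mul_cancel₀ hc0]
  -- The scaled class agrees with `c⁻¹ g` only almost everywhere; measure preservation carries this
  -- agreement to the translated point.
  · have hshift := (measurePreserving_add_right_haar
      ((θ / (2 * Real.pi) : ℝ) : UnitAddCircle)).quasiMeasurePreserving.ae_eq_comp hsmul
    filter_upwards [hsmul, hshift, hg] with x hx hx' hx''
    simp only [Function.comp_apply] at hx'
    rw [hx, hx', Pi.smul_apply, Pi.smul_apply, smul_mul_assoc, hx'']

end NCTorus

/-! ### Transfer between `ℝ/ℤ` and the unit circle. -/

theorem measurePreserving_toCircle :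
    MeasurePreserving (AddCircle.toCircle : UnitAddCircle → Circle) AddCircle.haarAddCircle
      circleMeasure :=
  ⟨AddCircle.continuous_toCircle.measurable, rfl⟩

theorem measurableEmbedding_toCircle :
    MeasurableEmbedding (AddCircle.toCircle : UnitAddCircle → Circle) := by
  have h : (circleHomeo : UnitAddCircle → Circle) = AddCircle.toCircle := funext circleHomeo_apply
  rw [← h]
  exact circleHomeo.measurableEmbedding

/-- Solutions on `ℝ/ℤ` and on the unit circle of a cohomological equation correspond. -/
theorem forall_solution_circle_iff (β : ℝ) (F : Circle → ℂ) :
    (∀ g : Lp ℂ 2 circleMeasure,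
      (∀ᵐ z ∂circleMeasure, g (NCTorus.rotation β z) * F z = g z) → g = 0) ↔
    ∀ g : Lp ℂ 2 (@AddCircle.haarAddCircle 1 _),
      (∀ᵐ x ∂AddCircle.haarAddCircle,
        g (x + (β : UnitAddCircle)) * F (AddCircle.toCircle x) = g x) → g = 0 := by
  have hemb := measurableEmbedding_toCircle
  have hmp := measurePreserving_toCircle
  have hae : ∀ p : Circle → Prop, (∀ᵐ z ∂circleMeasure, p z) ↔
      ∀ᵐ x ∂AddCircle.haarAddCircle, p (AddCircle.toCircle (x : UnitAddCircle)) :=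
    fun p => hemb.ae_map_iff
  have hrot := fun x : UnitAddCircle => rotation_toCircle β x
  constructor
  · intro H g hg
    -- Carrying `g` from `ℝ/ℤ` to the circle means composing with the inverse homeomorphism, which
    -- must preserve measure for the result to define an `L²` class.
    have hsymm : MeasurePreserving circleHomeo.symm circleMeasure AddCircle.haarAddCircle := by
      refine ⟨circleHomeo.symm.continuous.measurable, ?_⟩
      rw [← hmp.map_eq, Measure.map_map circleHomeo.symm.continuous.measurable hmp.measurable]
      convert Measure.map_id
      ext x
      rw [Function.comp_apply, ← circleHomeo_apply, Homeomorph.symm_apply_apply]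
      rfl
    have hmem := (Lp.memLp g).comp_measurePreserving hsymm
    have hco := (hae _).mp hmem.coeFn_toLp
    have hval : ∀ x, (g ∘ circleHomeo.symm) (AddCircle.toCircle x) = g x := fun x => by
      rw [Function.comp_apply, ← circleHomeo_apply, Homeomorph.symm_apply_apply]
    simp only [hval] at hco
    have h0 := H hmem.toLp <| (hae _).mpr <| by
      have hshift := (measurePreserving_add_right_haar
        (β : UnitAddCircle)).quasiMeasurePreserving.ae hco
      filter_upwards [hg, hco, hshift] with x hx hx' hx''
      rw [hrot, hx', hx'', hx]
    rw [Lp.eq_zero_iff_ae_eq_zero] at h0 ⊢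
    filter_upwards [hco, (hae _).mp h0] with x hx hx'
    rw [← hx, hx']
    rfl
  · intro H g hg
    have hmem := (Lp.memLp g).comp_measurePreserving hmp
    have hco := hmem.coeFn_toLp
    have h0 := H hmem.toLp <| by
      have hshift := (measurePreserving_add_right_haar
        (β : UnitAddCircle)).quasiMeasurePreserving.ae hco
      filter_upwards [(hae _).mp hg, hco, hshift] with x hx hx' hx''
      rw [hx', hx'', Function.comp_apply, Function.comp_apply, ← hrot, hx]
    rw [Lp.eq_zero_iff_ae_eq_zero] at h0 ⊢
    refine (hae _).mpr ?_
    filter_upwards [hco, h0] with x hx hx'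
    exact hx.symm.trans hx'

end

theorem mainTheorem3 (α θ : ℝ) (hθ : Irrational (θ / (2 * Real.pi))) (f : C(Circle, Circle)) :
    IsErgodicSystem (NCTorus.anzai α θ f) (NCTorus.trace α) ↔
      ∀ n : ℤ, n ≠ 0 → ∀ g : MeasureTheory.Lp ℂ 2 circleMeasure,
        (∀ᵐ z ∂circleMeasure,
          g (NCTorus.rotation (θ / (2 * Real.pi)) z) * NCTorus.cocycle α f n z = g z) →
        g = 0 := by
  have key := fun n : ℤ =>
    forall_solution_circle_iff (θ / (2 * Real.pi)) (NCTorus.cocycle α f n)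
  refine ⟨fun h n hn => (key n).mpr fun g hg => ?_, fun h => ?_⟩
  · exact NCTorus.eq_zero_of_isErgodicSystem hθ h hn hg
  · exact NCTorus.isErgodicSystem_of_no_solution hθ fun n hn => (key n).mp (h n hn)
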